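/- Let $n\ge 2$, $T\in(0,\infty]$, $C\in\mathbb R$, and let $\mu$ be a finite positive Borel measure on $\mathbb{R}^n$. Let $u(x,t)$ be a nonnegative weak solution on $\mathbb R^n\times(0,T)$ of $$\partial_t u=\nabla\cdot(u\,\nabla p),\qquad p=(-\Delta)^{-1}u,\qquad u(\cdot,0)=\mu ,$$ that is, for every finite $S\le T$: $u\in L^1(\mathbb R^n\times(0,S))$, $p\in L^1((0,S),W^{1,1}_{loc}(\mathbb R^n))$, $u\nabla p\in L^1(\mathbb R^n\times(0,S))$, and $$\int_0^S\!\!\int_{\mathbb R^n} (u\,\phi_t-u\,\nabla p\cdot\nabla\phi)\,dx\,dt+\int_{\mathbb R^n}\phi(x,0)\,d\mu(x)=0$$ for all $\phi\in C^1(\mathbb R^n\times[0,\infty))$ with compact support in $x$ that vanish for $t\ge S$. Here $(-\Delta)^{-1}u$ is the Newtonian potential of $u(\cdot,t)$ if $n\ge 3$; if $n=2$ it is the logarithmic potential, normalized by an additive constant: $p(x,t)=\frac1{2\pi}\int \log\frac{1+|y|}{|x-y|}\,u(y,t)\,dy$. Assume that $$\|u(\cdot,t)\|_{L^\infty(\mathbb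 R^n)}\le \frac Ct\qquad\text{for a.e. } t\in(0,T).$$ For $q\in[1,\infty)$ and positive measures $\nu,\nu'$ of the same mass put $W_q(\nu,\nu')^q=\inf_\gamma\iint|x-y|^q\,d\gamma(x,y)$, the infimum over all positive measures $\gamma$ on $\mathbb R^n\times\mathbb R^n$ with marginals $\nu$ and $\nu'$ (and $W_q(\nu,\nu')=\infty$ if the masses differ). Then there is a curve $(\nu_t)_{0\le t<T}$ of measures with $\nu_0=\mu$ and $\nu_t=u(\cdot,t)\,dx$ for a.e. $t\in(0,T)$ (for every $t\in(0,T)$ if $u$ is continuous on $\mathbb R^n\times(0,T)$) which is absolutely continuous, hence continuous, for $W_q$ for every $q\in[1,\infty)$: for every such $q$ there is a function $m$, in $L^1(0,S)$ for every finite $S\le T$, such that $$W_q(\nu_{t_2},\nu_{t_1})\le\int_{t_1}^{t_2}m(s)\,ds\qquad\text{for all }0\le t_1\le t_2<T,$$ and $t\mapsto\nu_t$ is continuous on $[0,T)$ with respect to $W_q$. -/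

import Mathlib

open MeasureTheory Set Filter Topology
open scoped ENNReal ContDiff

noncomputable section

namespace MeanField

/-- The Euclidean space `ℝⁿ`. -/
abbrev Space (n : ℕ) : Type := EuclideanSpace ℝ (Fin n)

/-- `N(x, y)`, the kernel of `(-Δ)⁻¹` on `ℝⁿ`, `n ≥ 2`.
For `n ≥ 3` it is the Newtonian kernel `|x - y|^(2-n) / ((n-2) |S^(n-1)|)`, where
`|S^(n-1)| = n |B(0,1)|`.  For `n = 2` it is the logarithmic kernel `-(1/2π) log |x - y|`, to which
the term `(1/2π) log (1 + |y|)`, which does not depend on `x`, is added: the integral against an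
arbitrary integrable density then converges, and it changes the usual logarithmic potential
(whenever that is defined) by an additive constant only. -/
def greenKernel (n : ℕ) (x y : Space n) : ℝ :=
  if n = 2 then
    1 / (2 * Real.pi) * Real.log ((1 + ‖y‖) / ‖x - y‖)
  else
    1 / (((n : ℝ) - 2) * ((n : ℝ) * volume.real (Metric.ball (0 : Space n) 1)))
      * (1 / ‖x - y‖ ^ (n - 2))

/-- The pressure `p = (-Δ)⁻¹ w` generated by the density `w` (in dimension two normalized by an
additive constant). -/
def pressure (n : ℕ) (w : Space n → ℝ) (x : Space n) : ℝ :=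
  ∫ y, greenKernel n x y * w y

/-- `f` belongs to `W^{1,1}_loc(ℝⁿ)` and `g` is its weak gradient. -/
structure IsWeakGradient {n : ℕ} (f : Space n → ℝ) (g : Space n → Space n) : Prop where
  locallyIntegrable : LocallyIntegrable f
  locallyIntegrable_grad : LocallyIntegrable g
  integral_eq : ∀ ψ : Space n → ℝ, ContDiff ℝ ∞ ψ → HasCompactSupport ψ → ∀ e : Space n,
    ∫ x, f x * fderiv ℝ ψ x e = -∫ x, inner ℝ (g x) e * ψ x

/-- Lebesgue measure on the space-time cylinder `(0,T) × ℝⁿ`. -/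
def cylinder (n : ℕ) (T : ℝ) : Measure (ℝ × Space n) :=
  (volume.restrict (Ioo 0 T)).prod volume

/-- Test functions for the initial value problem: continuously differentiable in time and space,
compactly supported in the space variable, vanishing for `t ≥ T`.  (A `C¹` function on
`[0,∞) × ℝⁿ` is the restriction of a `C¹` function on `ℝ × ℝⁿ`; only the values at `t ≥ 0`
matter.) -/
structure IsTestFunction (n : ℕ) (T : ℝ) (φ : ℝ × Space n → ℝ) : Prop where
  contDiff : ContDiff ℝ 1 φ
  compact_space : ∃ K : Set (Space n), IsCompact K ∧ ∀ t : ℝ, 0 ≤ t → ∀ x, x ∉ K → φ (t, x) = 0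
  vanish : ∀ t : ℝ, T ≤ t → ∀ x, φ (t, x) = 0

/-- `u` (written `u t x`) is a nonnegative weak solution on `(0,T) × ℝⁿ` of
`∂ₜu = ∇·(u ∇p)`, `p = (-Δ)⁻¹ u`, with initial datum the measure `μ`.
`G t` is the weak gradient `∇p(·,t)`.  No continuity of `u` is required. -/
def IsWeakSolution (n : ℕ) (T : ℝ) (μ : Measure (Space n)) (u : ℝ → Space n → ℝ) : Prop :=
  (∀ᵐ z ∂(cylinder n T), 0 ≤ u z.1 z.2) ∧
  Integrable (fun z : ℝ × Space n => u z.1 z.2) (cylinder n T) ∧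
  ∃ G : ℝ → Space n → Space n,
    -- `p ∈ L¹((0,T), W^{1,1}_loc)` and `G = ∇p`
    (∀ᵐ t ∂(volume.restrict (Ioo 0 T)), IsWeakGradient (pressure n (u t)) (G t)) ∧
    (∀ K : Set (Space n), IsCompact K →
      IntegrableOn (fun z : ℝ × Space n => pressure n (u z.1) z.2) (univ ×ˢ K) (cylinder n T) ∧
      IntegrableOn (fun z : ℝ × Space n => G z.1 z.2) (univ ×ˢ K) (cylinder n T)) ∧
    -- `u ∇p ∈ L¹((0,T) × ℝⁿ)`
    Integrable (fun z : ℝ × Space n => u z.1 z.2 • G z.1 z.2) (cylinder n T) ∧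
    -- `∬ (u φₜ - u ∇p · ∇φ) dx dt + ∫ φ(x,0) dμ(x) = 0`
    ∀ φ : ℝ × Space n → ℝ, IsTestFunction n T φ →
      (∫ z, (u z.1 z.2 * deriv (fun s : ℝ => φ (s, z.2)) z.1
          - u z.1 z.2 * fderiv ℝ (fun y : Space n => φ (z.1, y)) z.2 (G z.1 z.2)) ∂(cylinder n T))
        + ∫ x, φ (0, x) ∂μ = 0

/-- The `q`-Wasserstein distance between two positive measures (of the same mass), with values in
`[0,∞]`; it is `∞` if there is no coupling at all, i.e. if the masses are different. -/
def wasserstein {n : ℕ} (q : ℝ) (μ ν : Measure (Space n)) : ℝ≥0∞ :=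
  (⨅ (γ : Measure (Space n × Space n)) (_ : γ.map Prod.fst = μ ∧ γ.map Prod.snd = ν),
    ∫⁻ z, edist z.1 z.2 ^ q ∂γ) ^ (1 / q)

/-- The measure with Lebesgue density `w ≥ 0`. -/
def densityMeasure {n : ℕ} (w : Space n → ℝ) : Measure (Space n) :=
  volume.withDensity fun x => ENNReal.ofReal (w x)

end MeanField

end

noncomputable section

namespace MeanField

variable {n : ℕ}

/-! The density is transported with velocity `-∇p`, and this velocity is integrable in time,
uniformly in space. A density bounded by `B` with mass `M` has a pressure with Lipschitz constant at
most `c (B ρ + ρ^(1-n) M)` for every `ρ > 0`, since the kernel has a gradient of order `|x -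
y|^(1-n)` and the integral can be split at the radius `ρ`. With `B = |C|/t` and `ρ = t^(1/n)` this
is `K t^(1/n-1)`, which is integrable at `0`. So no mass should travel further than `R(t₂) - R(t₁)`
between the times `t₁` and `t₂`, where `R` is the primitive `travelBound` of `speedBound`. This is a
bound for the `∞`-Wasserstein distance, and it implies `W_q ≤ μ(ℝⁿ)^(1/q) (R(t₂) - R(t₁))` for all
`q`.

As there may be no flow to follow, the finite speed is extracted from the weak formulation. The test
function `g(d(x) + r(t) - l)`, with `g` a decreasing cutoff, `d` a smoothed distance to a compact
set `A` and `r' = κ` nearly the maximal speed, is almost nonincreasing along the motion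
(`exists_ae_moving_cutoff`). Hence the mass in `A` at a later time is at most the mass in the
`(R(t₂) - R(t₁))`-neighbourhood of `A` at the earlier time; this is the relation `Nearby`
(`nearby_of_integral_le`, `exists_good_times`).

A Strassen type theorem (`wasserstein_le_of_forall_isCompact`) turns this into couplings: on a fine
lattice the neighbourhood inequality is Hall's condition, and product measures on pairs of cells
realize the discrete transport.

The weak formulation gives this for almost all times only, and at time `0` for `μ`. Since `R` is
continuous, the curve extends to all times by tightness and weak limits (`exists_limit_measure`),
and a density continuous in time and space is recovered in the limit
(`eq_densityMeasure_of_nearby`). -/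

/-! ### Kernel estimates and the Lipschitz bound for the pressure -/

/-- Bernoulli's inequality for `(a / b) ^ k` with `a ≤ b`. The symmetric sum on the right avoids
having to know which of the two numbers is smaller. -/
theorem abs_inv_pow_sub_inv_pow_le (k : ℕ) {a b : ℝ} (ha : 0 < a) (hb : 0 < b) :
    |(a ^ k)⁻¹ - (b ^ k)⁻¹| ≤ k * |a - b| * ((a ^ (k + 1))⁻¹ + (b ^ (k + 1))⁻¹) := by
  have key : ∀ {a b : ℝ}, 0 < a → a ≤ b →
      |(a ^ k)⁻¹ - (b ^ k)⁻¹| ≤ k * |a - b| * ((a ^ (k + 1))⁻¹ + (b ^ (k + 1))⁻¹) := by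
    intro a b ha hab
    have hb : 0 < b := ha.trans_le hab
    have h1 : (b ^ k)⁻¹ ≤ (a ^ k)⁻¹ := by gcongr
    rw [abs_of_nonneg (sub_nonneg.2 h1), abs_of_nonpos (sub_nonpos.2 hab)]
    have h2 : 1 + (k : ℝ) * (a / b - 1) ≤ (a / b) ^ k := by
      have := one_add_mul_le_pow (a := a / b - 1) (by have := div_pos ha hb; linarith) k
      simpa using this
    have h3 : (a ^ k)⁻¹ - (b ^ k)⁻¹ = (a ^ k)⁻¹ * (1 - (a / b) ^ k) := by
      rw [div_pow]
      field_simp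
    have h4 : 1 - (a / b) ^ k ≤ k * ((b - a) / a) := by
      have : 1 - a / b ≤ (b - a) / a := by
        rw [one_sub_div hb.ne']
        exact div_le_div_of_nonneg_left (by linarith) ha hab
      nlinarith [(Nat.cast_nonneg k : (0 : ℝ) ≤ k)]
    calc (a ^ k)⁻¹ - (b ^ k)⁻¹ ≤ (a ^ k)⁻¹ * (k * ((b - a) / a)) := by rw [h3]; gcongr
      _ = k * (-(a - b)) * ((a ^ (k + 1))⁻¹ + 0) := by field_simp; ring
      _ ≤ _ := by
        have : 0 ≤ -(a - b) := by linarith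
        gcongr
        positivity
  rcases le_total a b with h | h
  · exact key ha h
  · rw [abs_sub_comm, abs_sub_comm a, add_comm (a ^ (k + 1))⁻¹]
    exact key hb h

theorem abs_log_sub_log_le {a b : ℝ} (ha : 0 < a) (hb : 0 < b) :
    |Real.log a - Real.log b| ≤ |a - b| * (a⁻¹ + b⁻¹) := by
  have key : ∀ {a b : ℝ}, 0 < a → a ≤ b →
      |Real.log a - Real.log b| ≤ |a - b| * (a⁻¹ + b⁻¹) := by
    intro a b ha hab
    have hb : 0 < b := ha.trans_le hab
    have h1 := Real.log_le_log ha hab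
    rw [abs_of_nonpos (sub_nonpos.2 h1), abs_of_nonpos (sub_nonpos.2 hab)]
    have h2 := Real.log_le_sub_one_of_pos (div_pos hb ha)
    rw [Real.log_div hb.ne' ha.ne'] at h2
    have h3 : b / a - 1 = (b - a) * a⁻¹ := by field_simp
    have h4 : 0 ≤ (b - a) * b⁻¹ := mul_nonneg (by linarith) (by positivity)
    nlinarith
  rcases le_total a b with h | h
  · exact key ha h
  · rw [abs_sub_comm, abs_sub_comm a, add_comm a⁻¹]
    exact key hb h

/-- A mean value estimate with values at the two endpoints only, so that a segment passing near `y`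
does no harm. For `n = 2` the normalizing term `log (1 + ‖y‖)` cancels in the difference. -/
theorem exists_abs_greenKernel_sub_le (hn : 2 ≤ n) :
    ∃ c : ℝ, 0 ≤ c ∧ ∀ x x' y : Space n, y ≠ x → y ≠ x' →
      |greenKernel n x y - greenKernel n x' y| ≤
        c * ‖x - x'‖ * ((‖x - y‖ ^ (n - 1))⁻¹ + (‖x' - y‖ ^ (n - 1))⁻¹) := by
  have hdist : ∀ x x' y : Space n, |‖x - y‖ - ‖x' - y‖| ≤ ‖x - x'‖ := fun x x' y => by
    simpa using abs_norm_sub_norm_le (x - y) (x' - y)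
  have hpos : ∀ x y : Space n, y ≠ x → 0 < ‖x - y‖ := fun x y h =>
    norm_pos_iff.2 (sub_ne_zero.2 h.symm)
  by_cases h2 : n = 2
  · refine ⟨1 / (2 * Real.pi), by positivity, fun x x' y hx hx' => ?_⟩
    have ha := hpos x y hx
    have hb := hpos x' y hx'
    have hy : 0 < 1 + ‖y‖ := by positivity
    rw [greenKernel, greenKernel, if_pos h2, if_pos h2, Real.log_div hy.ne' ha.ne',
      Real.log_div hy.ne' hb.ne', ← mul_sub, abs_mul, abs_of_nonneg (by positivity), mul_assoc]
    gcongr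
    rw [sub_sub_sub_cancel_left, abs_sub_comm]
    refine (abs_log_sub_log_le ha hb).trans ?_
    have : n - 1 = 1 := by omega
    rw [this, pow_one, pow_one]
    gcongr
    exact hdist x x' y
  · set A : ℝ := 1 / (((n : ℝ) - 2) * ((n : ℝ) * volume.real (Metric.ball (0 : Space n) 1)))
    refine ⟨|A| * (n - 2 : ℕ), by positivity, fun x x' y hx hx' => ?_⟩
    have ha := hpos x y hx
    have hb := hpos x' y hx'
    rw [greenKernel, greenKernel, if_neg h2, if_neg h2, ← mul_sub, abs_mul, mul_assoc, mul_assoc,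
      one_div (‖x - y‖ ^ _), one_div (‖x' - y‖ ^ _)]
    refine mul_le_mul_of_nonneg_left ?_ (abs_nonneg A)
    refine (abs_inv_pow_sub_inv_pow_le (n - 2) ha hb).trans ?_
    have : n - 2 + 1 = n - 1 := by omega
    rw [this, mul_assoc]
    gcongr
    exact hdist x x' y

theorem measurable_greenKernel (x : Space n) : Measurable (greenKernel n x) := by
  unfold greenKernel
  split_ifs <;> fun_prop

/-- The singular integral `∫ |x - y|^(1-n) |w(y)| dy` of a bounded integrable function. -/
theorem integral_inv_norm_pow_mul_abs_le (hn : 2 ≤ n) {w : Space n → ℝ} (hw : Integrable w)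
    {B : ℝ} (hB : ∀ᵐ y, |w y| ≤ B) {ρ : ℝ} (hρ : 0 < ρ) (x : Space n) :
    Integrable (fun y => (‖x - y‖ ^ (n - 1))⁻¹ * |w y|) ∧
      ∫ y, (‖x - y‖ ^ (n - 1))⁻¹ * |w y| ≤
        B * (n * volume.real (Metric.ball (0 : Space n) 1) * ρ) +
          (ρ ^ (n - 1))⁻¹ * ∫ y, |w y| := by
  have : Nonempty (Fin n) := ⟨⟨0, by omega⟩⟩
  set h : ℝ → ℝ := (Iio ρ).indicator fun r => (r ^ (n - 1))⁻¹
  have hdim : Module.finrank ℝ (Space n) = n := by simp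
  -- In polar coordinates the Jacobian `r ^ (n - 1)` cancels the singularity, so the truncated
  -- kernel has an integral linear in `ρ`.
  have hpow : EqOn (fun y : ℝ => y ^ (n - 1) • h y) ((Ioo 0 ρ).indicator fun _ => (1 : ℝ))
      (Ioi 0) := by
    intro r (hr : 0 < r)
    by_cases hr' : r < ρ
    · simp [h, hr, hr', (pow_pos hr _).ne']
    · simp [h, hr']
  have hint : Integrable (fun y : Space n => h ‖y‖) := by
    rw [integrable_fun_norm_addHaar volume, hdim]
    rw [integrableOn_congr_fun hpow measurableSet_Ioi]
    exact ((integrable_indicator_iff measurableSet_Ioo).2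
      (integrableOn_const (by simp))).integrableOn
  have hval : ∫ y : Space n, h ‖y‖ = n * volume.real (Metric.ball (0 : Space n) 1) * ρ := by
    rw [integral_fun_norm_addHaar volume, hdim, setIntegral_congr_fun measurableSet_Ioi hpow,
      setIntegral_indicator measurableSet_Ioo]
    have : Ioi (0 : ℝ) ∩ Ioo 0 ρ = Ioo 0 ρ := by ext; simp +contextual
    rw [this]
    simp [hρ.le, mul_assoc]
  have hint' : Integrable (fun y : Space n => h ‖x - y‖) := hint.comp_sub_left x
  have hval' : ∫ y : Space n, h ‖x - y‖ = n * volume.real (Metric.ball (0 : Space n) 1) * ρ := by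
    rw [← hval]; exact integral_sub_left_eq_self (fun y => h ‖y‖) volume x
  have hle : ∀ᵐ y, (‖x - y‖ ^ (n - 1))⁻¹ * |w y| ≤
      B * h ‖x - y‖ + (ρ ^ (n - 1))⁻¹ * |w y| := by
    filter_upwards [hB] with y hy
    by_cases hr : ‖x - y‖ < ρ
    · have : h ‖x - y‖ = (‖x - y‖ ^ (n - 1))⁻¹ := by simp [h, hr]
      rw [this, mul_comm B]
      have : 0 ≤ (ρ ^ (n - 1))⁻¹ * |w y| := by positivity
      have : (‖x - y‖ ^ (n - 1))⁻¹ * |w y| ≤ (‖x - y‖ ^ (n - 1))⁻¹ * B := by gcongr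
      linarith
    · have : h ‖x - y‖ = 0 := by simp [h, hr]
      rw [this, mul_zero, zero_add]
      push Not at hr
      gcongr
  have hdom : Integrable fun y => B * h ‖x - y‖ + (ρ ^ (n - 1))⁻¹ * |w y| :=
    (hint'.const_mul B).add (hw.abs.const_mul _)
  have hI : Integrable (fun y => (‖x - y‖ ^ (n - 1))⁻¹ * |w y|) := by
    refine hdom.mono' ?_ ?_
    · exact (by fun_prop : Measurable fun y => (‖x - y‖ ^ (n - 1))⁻¹).aestronglyMeasurable.mul
        hw.abs.aestronglyMeasurable
    · filter_upwards [hle] with y hy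
      rwa [Real.norm_of_nonneg (by positivity)]
  refine ⟨hI, (integral_mono_ae hI hdom hle).trans_eq ?_⟩
  rw [integral_add (hint'.const_mul B) (hw.abs.const_mul _), integral_const_mul,
    integral_const_mul, hval']

/-- The pressure of a bounded integrable density is Lipschitz. -/
theorem exists_lipschitzWith_pressure (hn : 2 ≤ n) :
    ∃ c : ℝ, 0 ≤ c ∧ ∀ (w : Space n → ℝ), Integrable w → ∀ B : ℝ, 0 ≤ B →
      (∀ᵐ y, |w y| ≤ B) → ∀ ρ : ℝ, 0 < ρ →
      LipschitzWith (Real.toNNReal (c * (B * ρ + (ρ ^ (n - 1))⁻¹ * ∫ y, |w y|)))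
        (pressure n w) := by
  have : Nonempty (Fin n) := ⟨⟨0, by omega⟩⟩
  obtain ⟨c, hc, hker⟩ := exists_abs_greenKernel_sub_le hn
  set b : ℝ := n * volume.real (Metric.ball (0 : Space n) 1)
  have hb : 0 ≤ b := by positivity
  -- The factor `2` accounts for the singularities at `x` and at `x'`; `b + 1` dominates the
  -- coefficients `b` and `1` of the two terms of `Q`.
  refine ⟨2 * c * (b + 1), by positivity, fun w hw B hB0 hB ρ hρ => ?_⟩
  have hI0 : 0 ≤ ∫ y, |w y| := integral_nonneg fun _ => abs_nonneg _
  set Q : ℝ := B * (b * ρ) + (ρ ^ (n - 1))⁻¹ * ∫ y, |w y|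
  have hQ : Q ≤ (b + 1) * (B * ρ + (ρ ^ (n - 1))⁻¹ * ∫ y, |w y|) := by
    have h1 : 0 ≤ B * ρ := by positivity
    have h2 : 0 ≤ (ρ ^ (n - 1))⁻¹ * ∫ y, |w y| := by positivity
    simp only [Q]
    nlinarith
  refine LipschitzWith.of_dist_le_mul fun x x' => ?_
  rw [Real.coe_toNNReal _ (by positivity), Real.dist_eq, dist_eq_norm]
  obtain ⟨hx, hxQ⟩ := integral_inv_norm_pow_mul_abs_le hn hw hB hρ x
  obtain ⟨hx', hxQ'⟩ := integral_inv_norm_pow_mul_abs_le hn hw hB hρ x'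
  have hne : ∀ z : Space n, ∀ᵐ y, y ≠ z := fun z => by
    simp [ae_iff]
  have hae : ∀ᵐ y, ‖greenKernel n x y * w y - greenKernel n x' y * w y‖ ≤
      c * ‖x - x'‖ * ((‖x - y‖ ^ (n - 1))⁻¹ * |w y| + (‖x' - y‖ ^ (n - 1))⁻¹ * |w y|) := by
    filter_upwards [hne x, hne x'] with y h1 h2
    rw [← sub_mul, norm_mul, Real.norm_eq_abs, Real.norm_eq_abs, ← add_mul, ← mul_assoc]
    gcongr
    exact hker x x' y h1 h2
  have hdom := (hx.add hx').const_mul (c * ‖x - x'‖)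
  have hmeas : ∀ z, AEStronglyMeasurable (fun y => greenKernel n z y * w y) volume := fun z =>
    (measurable_greenKernel z).aestronglyMeasurable.mul hw.aestronglyMeasurable
  have hdiff : Integrable (fun y => greenKernel n x y * w y - greenKernel n x' y * w y) :=
    hdom.mono' ((hmeas x).sub (hmeas x')) hae
  -- The difference of the integrands at `x` and `x'` is integrable, so they are integrable both or
  -- neither; in the second case both pressures have the default value `0`.
  by_cases hi : Integrable fun y => greenKernel n x y * w y
  · have hi' : Integrable fun y => greenKernel n x' y * w y := by
      refine (hi.sub hdiff).congr (.of_forall fun y => ?_)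
      simp
    rw [pressure, pressure, ← integral_sub hi hi', ← Real.norm_eq_abs]
    calc ‖∫ y, (greenKernel n x y * w y - greenKernel n x' y * w y)‖
        ≤ ∫ y, c * ‖x - x'‖ *
          ((‖x - y‖ ^ (n - 1))⁻¹ * |w y| + (‖x' - y‖ ^ (n - 1))⁻¹ * |w y|) :=
          norm_integral_le_of_norm_le hdom hae
      _ ≤ c * ‖x - x'‖ * (Q + Q) := by
          rw [integral_const_mul, integral_add hx hx']
          gcongr
      _ ≤ c * ‖x - x'‖ * (2 * ((b + 1) * (B * ρ + (ρ ^ (n - 1))⁻¹ * ∫ y, |w y|))) := by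
          gcongr; linarith
      _ = _ := by ring
  · have hi' : ¬ Integrable fun y => greenKernel n x' y * w y := fun h =>
      hi ((hdiff.add h).congr (.of_forall fun y => by simp))
    rw [pressure, pressure, integral_undef hi, integral_undef hi', sub_self, abs_zero]
    positivity

/-- A weak gradient of a Lipschitz function is bounded by the Lipschitz constant. -/
theorem IsWeakGradient.ae_norm_le {f : Space n → ℝ} {g : Space n → Space n}
    (h : IsWeakGradient f g) {L : NNReal} (hf : LipschitzWith L f) :
    ∀ᵐ x, ‖g x‖ ≤ L := by
  have hline : ∀ e : Space n, ∀ᵐ x, inner ℝ (g x) e = lineDeriv ℝ f x e := by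
    intro e
    have hloc : LocallyIntegrable (fun x => inner ℝ (g x) e) := fun x => by
      obtain ⟨s, hs, hi⟩ := h.locallyIntegrable_grad x
      exact ⟨s, hs, hi.inner_const e⟩
    -- The weak derivative and the almost everywhere line derivative of a Lipschitz function satisfy
    -- the same integration by parts formula, hence agree.
    refine ae_eq_of_integral_contDiff_smul_eq hloc (hf.locallyIntegrable_lineDeriv e)
      fun ψ hψ hψc => ?_
    obtain ⟨D, hD⟩ := hψ.lipschitzWith_of_hasCompactSupport hψc (by simp)
    have h1 := h.integral_eq ψ hψ hψc e
    have h2 := hf.integral_lineDeriv_mul_eq (μ := volume) hD hψc e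
    have h3 : ∀ x, lineDeriv ℝ ψ x (-e) * f x = -(f x * fderiv ℝ ψ x e) := fun x => by
      rw [(hψ.differentiable (by simp) x).lineDeriv_eq_fderiv]
      simp [mul_comm]
    simp only [smul_eq_mul, mul_comm (ψ _)]
    rw [h2]
    simp only [h3]
    rw [integral_neg, h1, neg_neg]
  -- Countably many directions share one null set; continuity in `e` then permits the choice `e = g
  -- x`.
  obtain ⟨D, hDc, hD⟩ := TopologicalSpace.exists_countable_dense (Space n)
  have := (ae_ball_iff hDc).2 fun e _ => hline e
  filter_upwards [this] with x hx
  have hle : ∀ e : Space n, inner ℝ (g x) e ≤ L * ‖e‖ := by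
    intro e
    refine hD.induction (P := fun e => inner ℝ (g x) e ≤ L * ‖e‖) (fun e he => ?_) ?_ e
    · rw [hx e he]
      exact (le_abs_self _).trans (norm_lineDeriv_le_of_lipschitz ℝ hf)
    · exact isClosed_le (by fun_prop) (by fun_prop)
  have h1 := hle (g x)
  rw [real_inner_self_eq_norm_mul_norm] at h1
  by_contra! hlt
  have : 0 < ‖g x‖ := L.2.trans_lt hlt
  nlinarith

/-! ### Weak inequalities in time -/

/-- A smoothed unit step. Composed with `t ↦ s - t` it is a time cutoff at `s` whose derivative is
minus a mollifier centred at `s`. -/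
theorem exists_primitive_contDiffBump (φ : ContDiffBump (0 : ℝ)) :
    ∃ P : ℝ → ℝ, (∀ x, HasDerivAt P (φ.normed volume x) x) ∧ Monotone P ∧
      (∀ x ≤ -φ.rOut, P x = 0) ∧ ∀ x, φ.rOut ≤ x → P x = 1 := by
  have hcont : Continuous (φ.normed volume) := φ.continuous_normed
  have hsupp : ∀ x, φ.rOut ≤ |x| → φ.normed volume x = 0 := fun x hx => by
    have : x ∉ Function.support (φ.normed volume) := by
      rw [φ.support_normed_eq]; simpa using hx
    simpa using this
  have hderiv : ∀ x, HasDerivAt (fun x => ∫ t in (-φ.rOut)..x, φ.normed volume t)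
      (φ.normed volume x) x := fun x =>
    intervalIntegral.integral_hasDerivAt_right (hcont.intervalIntegrable _ _)
      (hcont.stronglyMeasurableAtFilter _ _) hcont.continuousAt
  refine ⟨_, hderiv, monotone_of_hasDerivAt_nonneg hderiv fun x => φ.nonneg_normed x, ?_, ?_⟩
  · intro x hx
    rw [intervalIntegral.integral_congr (g := fun _ => 0)]
    · simp
    · intro t ht
      rw [uIcc_of_ge hx] at ht
      refine hsupp t ?_
      rw [abs_of_nonpos (by linarith [ht.2, φ.rOut_pos])]
      linarith [ht.2]
  · intro x hx
    rw [intervalIntegral.integral_eq_integral_of_support_subset, φ.integral_normed]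
    rw [φ.support_normed_eq, Real.ball_eq_Ioo]
    intro t ht
    simp only [zero_sub, zero_add, mem_Ioo] at ht
    exact ⟨ht.1, ht.2.le.trans hx⟩

/-- If the distributional derivative of `f` on `[0, S)`, with initial value `f₀`, is at most a
measure of mass `ε`, then `f` increases at most by `ε` between almost all times. -/
theorem exists_ae_le_add_of_forall_integral_deriv_le {S : ℝ} {f : ℝ → ℝ}
    (hf : IntegrableOn f (Ioo 0 S)) {f₀ ε : ℝ}
    (H : ∀ χ : ℝ → ℝ, ContDiff ℝ 1 χ → (∀ t, 0 ≤ χ t) → (∀ t, χ t ≤ 1) →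
      (∀ t, S ≤ t → χ t = 0) → -∫ t in Ioo 0 S, deriv χ t * f t ≤ χ 0 * f₀ + ε) :
    ∃ E : Set ℝ, (∀ᵐ t ∂volume.restrict (Ioo 0 S), t ∈ E) ∧ (∀ s ∈ E, f s ≤ f₀ + ε) ∧
      ∀ s ∈ E, ∀ s' ∈ E, s < s' → f s' ≤ f s + ε := by
  set F : ℝ → ℝ := (Ioo 0 S).indicator f
  have hF : LocallyIntegrable F := ((integrable_indicator_iff measurableSet_Ioo).2 hf).locallyIntegrable
  -- The outer radius is twice the inner one: a bounded ratio is what almost everywhere convergence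
  -- of the mollifications requires.
  let φ : ℕ → ContDiffBump (0 : ℝ) := fun i =>
    ⟨1 / (2 * ((i : ℝ) + 1)), 1 / ((i : ℝ) + 1), by positivity, by
      apply one_div_lt_one_div_of_lt <;> [positivity; linarith [(Nat.cast_nonneg i : (0 : ℝ) ≤ i)]]⟩
  have hφ : Tendsto (fun i => (φ i).rOut) atTop (𝓝 0) := tendsto_one_div_add_atTop_nhds_zero_nat
  have hφ' : ∀ᶠ i in atTop, (φ i).rOut ≤ 2 * (φ i).rIn := .of_forall fun i => by
    simp only [φ]
    apply le_of_eq
    field_simp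
  have hlim := ContDiffBump.ae_convolution_tendsto_right_of_locallyIntegrable hφ hφ' hF
  have hconv : ∀ i s, (MeasureTheory.convolution ((φ i).normed volume) F
      (ContinuousLinearMap.lsmul ℝ ℝ) volume) s =
        ∫ t in Ioo 0 S, (φ i).normed volume (s - t) * f t := by
    intro i s
    rw [convolution_eq_swap, ← integral_indicator measurableSet_Ioo]
    congr 1
    ext t
    by_cases ht : t ∈ Ioo 0 S <;> simp [F, ht]
  simp only [hconv] at hlim
  -- The good times are those at which the mollifications converge to `f s`. Cutting off at `s`
  -- compares `f s` with `f₀`; the difference of the cutoffs at `s'` and `s` vanishes at time `0`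
  -- and compares `f s'` with `f s`.
  refine ⟨{s | s ∈ Ioo 0 S ∧ Tendsto (fun i => ∫ t in Ioo 0 S, (φ i).normed volume (s - t) * f t)
    atTop (𝓝 (f s))}, ?_, ?_, ?_⟩
  · rw [ae_restrict_iff' measurableSet_Ioo]
    filter_upwards [hlim] with s hs hsS
    refine ⟨hsS, ?_⟩
    simpa [F, hsS] using hs
  · rintro s ⟨hsS, hs⟩
    refine le_of_tendsto hs ?_
    filter_upwards [hφ.eventually_lt_const (show (0 : ℝ) < min s (S - s) by
      simp [hsS.1, hsS.2])] with i hi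
    rw [lt_min_iff] at hi
    obtain ⟨P, hP, hmono, hP0, hP1⟩ := exists_primitive_contDiffBump (φ i)
    have hd : ∀ t, HasDerivAt (fun t => P (s - t)) (-(φ i).normed volume (s - t)) t := fun t => by
      simpa using (hP (s - t)).comp_const_sub s t
    have hPle : ∀ x, P x ≤ 1 := fun x =>
      (hmono (le_max_left x (φ i).rOut)).trans_eq (hP1 _ (le_max_right _ _))
    have hPge : ∀ x, 0 ≤ P x := fun x =>
      (hP0 _ (min_le_right x (-(φ i).rOut))).symm.trans_le (hmono (min_le_left _ _))
    have := H (fun t => P (s - t)) (contDiff_one_iff_deriv.2 ⟨fun t => (hd t).differentiableAt, by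
      rw [funext fun t => (hd t).deriv]
      exact ((φ i).continuous_normed.comp (continuous_const.sub continuous_id)).neg⟩)
      (fun t => hPge _) (fun t => hPle _) (fun t ht => hP0 _ (by linarith))
    simp only [(hd _).deriv, sub_zero, hP1 s hi.1.le, one_mul, neg_mul, integral_neg, neg_neg]
      at this
    exact this
  · rintro s ⟨hsS, hs⟩ s' ⟨hsS', hs'⟩ hss
    suffices f s' - f s ≤ ε by linarith
    refine le_of_tendsto (hs'.sub hs) ?_
    filter_upwards [hφ.eventually_lt_const (show (0 : ℝ) < min s (S - s') by
      simp [hsS.1, hsS'.2])] with i hi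
    rw [lt_min_iff] at hi
    obtain ⟨P, hP, hmono, hP0, hP1⟩ := exists_primitive_contDiffBump (φ i)
    have hd : ∀ t, HasDerivAt (fun t => P (s' - t) - P (s - t))
        (-(φ i).normed volume (s' - t) - -(φ i).normed volume (s - t)) t := fun t => by
      exact ((hP (s' - t)).comp_const_sub s' t).fun_sub ((hP (s - t)).comp_const_sub s t)
    have hPle : ∀ x, P x ≤ 1 := fun x =>
      (hmono (le_max_left x (φ i).rOut)).trans_eq (hP1 _ (le_max_right _ _))
    have hPge : ∀ x, 0 ≤ P x := fun x =>
      (hP0 _ (min_le_right x (-(φ i).rOut))).symm.trans_le (hmono (min_le_left _ _))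
    have := H (fun t => P (s' - t) - P (s - t))
      (contDiff_one_iff_deriv.2 ⟨fun t => (hd t).differentiableAt, by
      rw [funext fun t => (hd t).deriv]
      exact ((φ i).continuous_normed.comp (continuous_const.sub continuous_id)).neg.sub
        ((φ i).continuous_normed.comp (continuous_const.sub continuous_id)).neg⟩)
      (fun t => sub_nonneg.2 (hmono (by linarith)))
      (fun t => by linarith [hPle (s' - t), hPge (s - t)])
      (fun t ht => by rw [hP0 _ (by linarith), hP0 _ (by linarith), sub_zero])
    have hint : ∀ s, IntegrableOn (fun t => (φ i).normed volume (s - t) * f t) (Ioo 0 S) := by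
      intro s
      obtain ⟨c, hc⟩ := (φ i).continuous_normed (μ := volume)
        |>.bounded_above_of_compact_support (φ i).hasCompactSupport_normed
      exact hf.bdd_mul ((φ i).continuous_normed.comp
        (continuous_const.sub continuous_id)).aestronglyMeasurable (.of_forall fun t => hc (s - t))
    simp only [(hd _).deriv, sub_zero, hP1 s hi.1.le, hP1 s' (hi.1.le.trans hss.le), sub_self,
      zero_mul, zero_add] at this
    rw [← integral_sub (hint s') (hint s)]
    rw [← integral_neg] at this
    refine le_trans (le_of_eq ?_) this
    congr 1
    ext t
    ring

/-- The weak formulation with the test function `χ(t) Φ(t,x)`. -/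
theorem exists_ae_le_add_of_weak {S : ℝ} {μ : Measure (Space n)} [IsFiniteMeasure μ]
    {u : ℝ → Space n → ℝ} {G : ℝ → Space n → Space n}
    (hu : Integrable (fun z : ℝ × Space n => u z.1 z.2) (cylinder n S))
    (huG : Integrable (fun z : ℝ × Space n => u z.1 z.2 • G z.1 z.2) (cylinder n S))
    (hweak : ∀ φ : ℝ × Space n → ℝ, IsTestFunction n S φ →
      (∫ z, (u z.1 z.2 * deriv (fun s : ℝ => φ (s, z.2)) z.1
          - u z.1 z.2 * fderiv ℝ (fun y : Space n => φ (z.1, y)) z.2 (G z.1 z.2)) ∂(cylinder n S))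
        + ∫ x, φ (0, x) ∂μ = 0)
    {Φ : ℝ × Space n → ℝ} (hΦ : ContDiff ℝ 1 Φ) {K : Set (Space n)} (hK : IsCompact K)
    (hΦK : ∀ t : ℝ, 0 ≤ t → ∀ x, x ∉ K → Φ (t, x) = 0)
    {h : ℝ × Space n → ℝ} (hh : Integrable h (cylinder n S)) (h0 : ∀ᵐ z ∂cylinder n S, 0 ≤ h z)
    (hle : ∀ᵐ z ∂cylinder n S, u z.1 z.2 * fderiv ℝ Φ z (1, -G z.1 z.2) ≤ h z)
    {ε : ℝ} (hε : ∫ z, h z ∂cylinder n S ≤ ε) :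
    ∃ E : Set ℝ, (∀ᵐ t ∂volume.restrict (Ioo 0 S), t ∈ E) ∧
      (∀ s ∈ E, ∫ x, u s x * Φ (s, x) ≤ (∫ x, Φ (0, x) ∂μ) + ε) ∧
      ∀ s ∈ E, ∀ s' ∈ E, s < s' → ∫ x, u s' x * Φ (s', x) ≤ (∫ x, u s x * Φ (s, x)) + ε := by
  have hcyl : ∀ᵐ z ∂cylinder n S, z.1 ∈ Ioo 0 S :=
    Measure.quasiMeasurePreserving_fst.ae (ae_restrict_mem measurableSet_Ioo)
  have hcomp : IsCompact (Icc 0 S ×ˢ K) := isCompact_Icc.prod hK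
  obtain ⟨b₁, hb₁⟩ := hcomp.exists_bound_of_continuousOn hΦ.continuous.continuousOn
  obtain ⟨b₂, hb₂⟩ := hcomp.exists_bound_of_continuousOn
    (hΦ.continuous_fderiv (by simp)).continuousOn
  have hB₁ : ∀ᵐ z ∂cylinder n S, ‖Φ z‖ ≤ max b₁ 0 := by
    filter_upwards [hcyl] with z hz
    by_cases hzK : z.2 ∈ K
    · exact (hb₁ z ⟨Ioo_subset_Icc_self hz, hzK⟩).trans (le_max_left _ _)
    · simp [hΦK z.1 hz.1.le z.2 hzK]
  have hB₂ : ∀ᵐ z ∂cylinder n S, ‖fderiv ℝ Φ z‖ ≤ max b₂ 0 := by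
    filter_upwards [hcyl] with z hz
    by_cases hzK : z.2 ∈ K
    · exact (hb₂ z ⟨Ioo_subset_Icc_self hz, hzK⟩).trans (le_max_left _ _)
    -- `Φ` is known to vanish off `K` only for nonnegative times, so the neighbourhood is taken
    -- inside positive times.
    · have : Φ =ᶠ[𝓝 z] fun _ => 0 := by
        filter_upwards [(isOpen_Ioi.prod hK.isClosed.isOpen_compl).mem_nhds
          (show z ∈ Ioi 0 ×ˢ Kᶜ from ⟨hz.1, hzK⟩)] with y hy
        exact hΦK y.1 (le_of_lt hy.1) y.2 hy.2
      simp [this.fderiv_eq]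
  have huΦ : Integrable (fun z : ℝ × Space n => u z.1 z.2 * Φ z) (cylinder n S) :=
    hu.mul_bdd hΦ.continuous.aestronglyMeasurable hB₁
  have hflux : Integrable (fun z : ℝ × Space n => u z.1 z.2 * fderiv ℝ Φ z (1, -G z.1 z.2))
      (cylinder n S) := by
    -- Linearity moves `u` into the argument of the derivative, since measurability is given for `u
    -- • G` and not for `G`.
    have hvec : Integrable (fun z : ℝ × Space n => (u z.1 z.2, -(u z.1 z.2 • G z.1 z.2)))
      (cylinder n S) := hu.prodMk huG.neg
    have hmeas : AEStronglyMeasurable (fun z : ℝ × Space n =>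
        fderiv ℝ Φ z (u z.1 z.2, -(u z.1 z.2 • G z.1 z.2))) (cylinder n S) :=
      isBoundedBilinearMap_apply.continuous.comp_aestronglyMeasurable
        ((hΦ.continuous_fderiv (by simp)).aestronglyMeasurable.prodMk hvec.aestronglyMeasurable)
    refine ((hvec.norm.const_mul (max b₂ 0)).mono' hmeas ?_).congr (.of_forall fun z => ?_)
    · filter_upwards [hB₂] with z hz
      exact ContinuousLinearMap.le_of_opNorm_le _ hz _
    · dsimp only
      rw [← smul_eq_mul, ← map_smul]
      simp
  have hf : IntegrableOn (fun t => ∫ x, u t x * Φ (t, x)) (Ioo 0 S) := huΦ.integral_prod_left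
  refine exists_ae_le_add_of_forall_integral_deriv_le hf fun χ hχ hχ0 hχ1 hχS => ?_
  have hdχ : Continuous (deriv χ) := hχ.continuous_deriv le_rfl
  have htest : IsTestFunction n S fun z => χ z.1 * Φ z :=
    ⟨(hχ.comp contDiff_fst).mul hΦ, ⟨K, hK, fun t ht x hx => by simp [hΦK t ht x hx]⟩,
      fun t ht x => by simp [hχS t ht]⟩
  have hΦd : ∀ z, HasFDerivAt Φ (fderiv ℝ Φ z) z := fun z =>
    (hΦ.differentiable (by simp) z).hasFDerivAt
  have key := hweak _ htest
  have hint : ∀ z : ℝ × Space n,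
      u z.1 z.2 * deriv (fun s : ℝ => χ s * Φ (s, z.2)) z.1
          - u z.1 z.2 * fderiv ℝ (fun y : Space n => χ z.1 * Φ (z.1, y)) z.2 (G z.1 z.2) =
        deriv χ z.1 * (u z.1 z.2 * Φ z) + χ z.1 * (u z.1 z.2 * fderiv ℝ Φ z (1, -G z.1 z.2)) := by
    rintro ⟨t, x⟩
    have h1 : HasDerivAt (fun s : ℝ => Φ (s, x)) (fderiv ℝ Φ (t, x) (1, 0)) t :=
      (hΦd (t, x)).comp_hasDerivAt t ((hasDerivAt_id t).prodMk (hasDerivAt_const t x))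
    have h2 : HasFDerivAt (fun y : Space n => Φ (t, y))
        ((fderiv ℝ Φ (t, x)).comp (ContinuousLinearMap.inr ℝ ℝ (Space n))) x :=
      (hΦd (t, x)).comp x (hasFDerivAt_prodMk_right t x)
    have h3 : HasDerivAt χ (deriv χ t) t := (hχ.differentiable (by simp) t).hasDerivAt
    have h4 : ((1 : ℝ), -G t x) = (1, 0) - (0, G t x) := by simp
    dsimp only
    rw [(h3.fun_mul h1).deriv, (h2.const_mul (χ t)).fderiv, h4, map_sub]
    simp only [smul_apply, ContinuousLinearMap.comp_apply,
      ContinuousLinearMap.inr_apply, smul_eq_mul]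
    ring
  simp only [hint] at key
  have hdχb : ∃ b, ∀ᵐ z ∂cylinder n S, ‖deriv χ z.1‖ ≤ b := by
    obtain ⟨b, hb⟩ := (isCompact_Icc (a := 0) (b := S)).exists_bound_of_continuousOn
      hdχ.continuousOn
    exact ⟨b, hcyl.mono fun z hz => hb _ (Ioo_subset_Icc_self hz)⟩
  obtain ⟨b, hb⟩ := hdχb
  have hI₁ : Integrable (fun z : ℝ × Space n => deriv χ z.1 * (u z.1 z.2 * Φ z)) (cylinder n S) :=
    huΦ.bdd_mul (hdχ.comp continuous_fst).aestronglyMeasurable hb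
  have hI₂ : Integrable (fun z : ℝ × Space n =>
      χ z.1 * (u z.1 z.2 * fderiv ℝ Φ z (1, -G z.1 z.2))) (cylinder n S) :=
    hflux.bdd_mul (c := 1) (hχ.continuous.comp continuous_fst).aestronglyMeasurable
      (.of_forall fun z => by rw [Real.norm_of_nonneg (hχ0 _)]; exact hχ1 _)
  rw [integral_add hI₁ hI₂] at key
  have hF : ∫ z : ℝ × Space n, deriv χ z.1 * (u z.1 z.2 * Φ z) ∂cylinder n S =
      ∫ t in Ioo 0 S, deriv χ t * ∫ x, u t x * Φ (t, x) := by
    unfold cylinder at hI₁ ⊢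
    rw [integral_prod _ hI₁]
    simp only [integral_const_mul]
  have hflux_le : ∫ z : ℝ × Space n, χ z.1 * (u z.1 z.2 * fderiv ℝ Φ z (1, -G z.1 z.2))
      ∂cylinder n S ≤ ε := by
    refine (integral_mono_ae hI₂ hh ?_).trans hε
    filter_upwards [hle, h0] with z hz h0z
    calc χ z.1 * (u z.1 z.2 * fderiv ℝ Φ z (1, -G z.1 z.2)) ≤ χ z.1 * h z := by
          gcongr; exact hχ0 _
      _ ≤ 1 * h z := by gcongr; exact hχ1 _
      _ = h z := one_mul _
  rw [hF, integral_const_mul] at key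
  linarith

/-! ### Couplings from Hall's marriage theorem -/

/-- Hall's theorem with integer multiplicities. -/
theorem exists_nat_transport_of_hall {ι κ : Type*} [DecidableEq ι] [DecidableEq κ] (a : ι → ℕ)
    (b : κ → ℕ) (nb : κ → Finset ι)
    (H : ∀ J : Finset κ, ∑ j ∈ J, b j ≤ ∑ i ∈ J.biUnion nb, a i) :
    ∃ g : κ → ι → ℕ, (∀ j, ∀ i ∉ nb j, g j i = 0) ∧ (∀ j, ∑ i ∈ nb j, g j i = b j) ∧
      ∀ i (J : Finset κ), ∑ j ∈ J, g j i ≤ a i := by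
  -- Each vertex is replaced by as many copies as its multiplicity, and a matching of the copies is
  -- counted fibrewise.
  let t : (Σ j, Fin (b j)) → Finset (Σ i, Fin (a i)) := fun p =>
    (nb p.1).sigma fun _ => Finset.univ
  have hall : ∀ s : Finset (Σ j, Fin (b j)), s.card ≤ (s.biUnion t).card := by
    intro s
    set J := s.image Sigma.fst
    have h1 : s ⊆ J.sigma fun _ => Finset.univ := fun p hp => by
      simp only [Finset.mem_sigma, Finset.mem_univ, and_true]
      exact Finset.mem_image_of_mem _ hp
    have h2 : (J.biUnion nb).sigma (fun i => (Finset.univ : Finset (Fin (a i)))) ⊆ s.biUnion t := by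
      rintro ⟨i, k⟩ hik
      simp only [J, Finset.mem_sigma, Finset.mem_biUnion, Finset.mem_image, Finset.mem_univ,
        and_true] at hik
      obtain ⟨j, ⟨p, hp, rfl⟩, hi⟩ := hik
      simp only [t, Finset.mem_biUnion, Finset.mem_sigma, Finset.mem_univ, and_true]
      exact ⟨p, hp, hi⟩
    calc s.card ≤ _ := Finset.card_le_card h1
      _ = ∑ j ∈ J, b j := by simp
      _ ≤ _ := H J
      _ = ((J.biUnion nb).sigma fun i => (Finset.univ : Finset (Fin (a i)))).card := by
        rw [Finset.card_sigma]; simp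
      _ ≤ _ := Finset.card_le_card h2
  obtain ⟨f, hf, hft⟩ := (Finset.all_card_le_biUnion_card_iff_exists_injective t).1 hall
  have hfnb : ∀ p, (f p).1 ∈ nb p.1 := fun p => (Finset.mem_sigma.1 (hft p)).1
  refine ⟨fun j i => (Finset.univ.filter fun k : Fin (b j) => (f ⟨j, k⟩).1 = i).card,
    fun j i hi => ?_, fun j => ?_, fun i J => ?_⟩
  · rw [Finset.card_eq_zero, Finset.filter_eq_empty_iff]
    rintro k - rfl
    exact hi (hfnb ⟨j, k⟩)
  · rw [← Finset.card_eq_sum_card_fiberwise (s := Finset.univ) (f := fun k : Fin (b j) => (f ⟨j, k⟩).1)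
      (fun k _ => hfnb ⟨j, k⟩)]
    simp
  · rw [← Finset.card_sigma, ← Finset.card_image_of_injective _ hf]
    calc _ ≤ (({i} : Finset ι).sigma fun i => (Finset.univ : Finset (Fin (a i)))).card := by
          refine Finset.card_le_card fun p hp => ?_
          obtain ⟨q, hq, rfl⟩ := Finset.mem_image.1 hp
          simpa using (Finset.mem_filter.1 (Finset.mem_sigma.1 hq).2).2
      _ = a i := by simp

/-- Hall's theorem with real weights. -/
theorem exists_transport_of_hall {ι κ : Type*} [DecidableEq ι] [DecidableEq κ] (a : ι → ℝ)
    (b : κ → ℝ) (ha : ∀ i, 0 ≤ a i) (hb : ∀ j, 0 ≤ b j) (nb : κ → Finset ι)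
    (H : ∀ J : Finset κ, ∑ j ∈ J, b j ≤ ∑ i ∈ J.biUnion nb, a i) :
    ∃ g : κ → ι → ℝ, (∀ j i, 0 ≤ g j i) ∧ (∀ j, ∀ i ∉ nb j, g j i = 0) ∧
      (∀ j, ∑ i ∈ nb j, g j i = b j) ∧ ∀ i (J : Finset κ), ∑ j ∈ J, g j i ≤ a i := by
  -- Scale by `N`, rounding demand down and supply up: this preserves Hall's condition, and the
  -- rounding disappears after division by `N`.
  have step : ∀ N : ℕ, ∃ g : κ → ι → ℕ, (∀ j, ∀ i ∉ nb j, g j i = 0) ∧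
      (∀ j, ∑ i ∈ nb j, g j i = ⌊b j * N⌋₊) ∧
      ∀ i (J : Finset κ), ∑ j ∈ J, g j i ≤ ⌈a i * N⌉₊ := by
    intro N
    refine exists_nat_transport_of_hall _ _ nb fun J => ?_
    have : (∑ j ∈ J, (⌊b j * N⌋₊ : ℝ)) ≤ ∑ i ∈ J.biUnion nb, (⌈a i * N⌉₊ : ℝ) :=
      calc (∑ j ∈ J, (⌊b j * N⌋₊ : ℝ)) ≤ ∑ j ∈ J, b j * N :=
            Finset.sum_le_sum fun j _ => Nat.floor_le (mul_nonneg (hb j) N.cast_nonneg)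
        _ = (∑ j ∈ J, b j) * N := by rw [Finset.sum_mul]
        _ ≤ (∑ i ∈ J.biUnion nb, a i) * N := by gcongr; exact H J
        _ = ∑ i ∈ J.biUnion nb, a i * N := by rw [Finset.sum_mul]
        _ ≤ _ := Finset.sum_le_sum fun i _ => Nat.le_ceil _
    exact_mod_cast this
  choose g hg0 hgb hga using step
  have hle : ∀ N j i, (g N j i : ℝ) / N ∈ Icc 0 (b j) := by
    intro N j i
    refine ⟨by positivity, ?_⟩
    rcases Nat.eq_zero_or_pos N with rfl | hN
    · simpa using hb j
    rw [div_le_iff₀ (by exact_mod_cast hN)]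
    refine le_trans ?_ (Nat.floor_le (mul_nonneg (hb j) N.cast_nonneg))
    rw [← hgb N j]
    by_cases hi : i ∈ nb j
    · exact_mod_cast Finset.single_le_sum (f := fun i => g N j i) (fun _ _ => Nat.zero_le _) hi
    · rw [hg0 N j i hi]; exact_mod_cast Nat.zero_le _
  -- An ultrafilter makes all the bounded entries converge at once, with no extraction of
  -- subsequences.
  let U : Ultrafilter ℕ := hyperfilter ℕ
  have hU : (U : Filter ℕ) ≤ atTop := Nat.hyperfilter_le_atTop
  have hlim : ∀ j i, ∃ l ∈ Icc 0 (b j), Tendsto (fun N => (g N j i : ℝ) / N) U (𝓝 l) := by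
    intro j i
    exact isCompact_Icc.ultrafilter_le_nhds (U.map fun N => (g N j i : ℝ) / N)
      (Filter.le_principal_iff.2 (Filter.mem_map.2 (Filter.univ_mem' fun N => hle N j i)))
  choose l hl hlt using hlim
  refine ⟨l, fun j i => (hl j i).1, fun j i hi => ?_, fun j => ?_, fun i J => ?_⟩
  · refine tendsto_nhds_unique (hlt j i) ?_
    simp only [hg0 _ j i hi]
    simp
  · refine tendsto_nhds_unique (tendsto_finsetSum (nb j) fun i _ => hlt j i) ?_
    refine ((tendsto_nat_floor_mul_div_atTop (hb j)).comp
      (tendsto_natCast_atTop_atTop (R := ℝ))).mono_left hU |>.congr fun N => ?_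
    simp only [Function.comp_apply]
    rw [← hgb N j, ← Finset.sum_div]
    push_cast
    rfl
  · refine le_of_tendsto_of_tendsto (tendsto_finsetSum J fun j _ => hlt j i)
      (((tendsto_nat_ceil_mul_div_atTop (ha i)).comp
      (tendsto_natCast_atTop_atTop (R := ℝ))).mono_left hU) (.of_forall fun N => ?_)
    simp only [Function.comp_apply]
    rw [← Finset.sum_div]
    gcongr
    exact_mod_cast hga N i J

/-- The marginal computation for a combination of product measures with weights `g j i / (b j * a
i)`. Cells of measure zero are separate cases because their weights are degenerate. -/
theorem tsum_transport_mul {ι κ : Type*} {g : κ → ι → ℝ≥0∞} {a : ι → ℝ≥0∞} {b m : κ → ℝ≥0∞}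
    (ha : ∀ i, a i ≠ ⊤) (hb : ∀ j, b j ≠ ⊤) (hga : ∀ j i, g j i ≤ a i)
    (hgb : ∀ j, ∑' i, g j i = b j) (hm : ∀ j, m j ≤ b j) :
    ∑' j, ∑' i, g j i / (b j * a i) * (m j * a i) = ∑' j, m j := by
  refine tsum_congr fun j => ?_
  by_cases hbj : b j = 0
  · have : m j = 0 := le_antisymm (hbj ▸ hm j) zero_le
    simp [this]
  have : ∀ i, g j i / (b j * a i) * (m j * a i) = g j i * (m j / b j) := by
    intro i
    by_cases hai : a i = 0
    · have : g j i = 0 := le_antisymm (hai ▸ hga j i) zero_le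
      simp [this]
    rw [ENNReal.div_eq_inv_mul, ENNReal.mul_inv (.inl hbj) (.inl (hb j)), ENNReal.div_eq_inv_mul]
    calc (b j)⁻¹ * (a i)⁻¹ * g j i * (m j * a i)
        = g j i * ((b j)⁻¹ * m j) * ((a i)⁻¹ * a i) := by ring
      _ = _ := by rw [ENNReal.inv_mul_cancel hai (ha i), mul_one]
  simp only [this]
  rw [ENNReal.tsum_mul_right, hgb j, ENNReal.mul_div_cancel (fun h => absurd h hbj) (fun h => absurd h (hb j))]

/-- A coupling of two measures which only moves mass between neighbouring cells of a partition,
under Hall's condition. -/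
theorem exists_coupling_of_hall {X ι : Type*} [MeasurableSpace X] [Countable ι] [DecidableEq ι]
    {c : X → ι} (hc : ∀ s : Set ι, MeasurableSet (c ⁻¹' s)) (ν ν' : Measure X) [IsFiniteMeasure ν]
    [IsFiniteMeasure ν'] (hmass : ν univ = ν' univ) (nb : ι → Finset ι)
    (H : ∀ J : Finset ι, ν (c ⁻¹' J) ≤ ν' (c ⁻¹' (J.biUnion nb : Finset ι))) :
    ∃ γ : Measure (X × X), γ.map Prod.fst = ν ∧ γ.map Prod.snd = ν' ∧
      ∀ᵐ z ∂γ, c z.2 ∈ nb (c z.1) := by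
  set Q : ι → Set X := fun i => c ⁻¹' {i} with hQ
  have hQm : ∀ i, MeasurableSet (Q i) := fun i => hc _
  have hdisj : Pairwise (Function.onFun Disjoint Q) := fun i j hij =>
    Disjoint.preimage _ (by simpa using hij)
  have hunion : ∀ (ν : Measure X) (J : Finset ι), ν (c ⁻¹' J) = ∑ j ∈ J, ν (Q j) := by
    intro ν J
    rw [← measure_biUnion_finset (fun i _ j _ h => hdisj h) fun i _ => hQm i]
    congr 1
    ext x
    simp [Q]
  have htot : ∀ (ν : Measure X) (s : Set X), MeasurableSet s → ∑' j, ν (s ∩ Q j) = ν s := by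
    intro ν s hs
    rw [← measure_iUnion (fun i j h => (hdisj h).mono inter_subset_right inter_subset_right)
      fun i => hs.inter (hQm i), ← inter_iUnion]
    congr 1
    rw [inter_eq_left]
    intro x _
    simp [Q]
  obtain ⟨g, hg0, hgnb, hgb, hga⟩ := exists_transport_of_hall (fun i => (ν' (Q i)).toReal)
    (fun j => (ν (Q j)).toReal) (fun _ => ENNReal.toReal_nonneg) (fun _ => ENNReal.toReal_nonneg)
    nb (fun J => by
      have h1 := H J
      rw [hunion, hunion] at h1
      rw [← ENNReal.toReal_sum (fun _ _ => measure_ne_top _ _),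
        ← ENNReal.toReal_sum (fun _ _ => measure_ne_top _ _)]
      exact ENNReal.toReal_mono (by simp [ENNReal.sum_eq_top]) h1)
  set G : ι → ι → ℝ≥0∞ := fun j i => ENNReal.ofReal (g j i)
  have hGb : ∀ j, ∑' i, G j i = ν (Q j) := by
    intro j
    rw [tsum_eq_sum (s := nb j) fun i hi => by simp [G, hgnb j i hi],
      ← ENNReal.ofReal_sum_of_nonneg fun i _ => hg0 j i, hgb j,
      ENNReal.ofReal_toReal (measure_ne_top _ _)]
  have hGa' : ∀ i, ∑' j, G j i ≤ ν' (Q i) := by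
    intro i
    rw [ENNReal.tsum_eq_iSup_sum]
    refine iSup_le fun J => ?_
    rw [← ENNReal.ofReal_sum_of_nonneg fun j _ => hg0 j i,
      ← ENNReal.ofReal_toReal (measure_ne_top ν' (Q i))]
    exact ENNReal.ofReal_le_ofReal (hga i J)
  have hsum : ∑' i, ∑' j, G j i = ∑' i, ν' (Q i) := by
    rw [ENNReal.tsum_comm]
    simp only [hGb]
    have h1 := htot ν univ .univ
    have h2 := htot ν' univ .univ
    simp only [univ_inter] at h1 h2
    rw [h1, h2, hmass]
  have hfin : ∑' i, ν' (Q i) ≠ ⊤ := by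
    have h2 := htot ν' univ .univ
    simp only [univ_inter] at h2
    rw [h2]
    exact measure_ne_top _ _
  -- Hall's theorem only bounds the mass received by each cell; since the total masses are equal and
  -- finite, none of these bounds can be strict.
  have hGa : ∀ i, ∑' j, G j i = ν' (Q i) := by
    intro i
    refine le_antisymm (hGa' i) ?_
    by_contra! hlt
    exact (ENNReal.tsum_lt_tsum (hsum ▸ hfin) hGa' hlt).ne hsum
  have hle1 : ∀ j i, G j i ≤ ν (Q j) := fun j i => hGb j ▸ ENNReal.le_tsum i
  have hle2 : ∀ j i, G j i ≤ ν' (Q i) := fun j i => hGa i ▸ ENNReal.le_tsum j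
  -- The mass `G j i` sent from cell `j` to cell `i` is spread as a normalized product measure.
  set γ : Measure (X × X) := Measure.sum fun p : ι × ι =>
    (G p.1 p.2 / (ν (Q p.1) * ν' (Q p.2))) • (ν.restrict (Q p.1)).prod (ν'.restrict (Q p.2))
  refine ⟨γ, ?_, ?_, ?_⟩
  · ext s hs
    rw [Measure.map_apply measurable_fst hs, Measure.sum_apply _ (measurable_fst hs),
      ENNReal.tsum_prod', ← htot ν s hs,
      ← tsum_transport_mul (fun i => measure_ne_top ν' (Q i)) (fun j => measure_ne_top ν (Q j))
        hle2 hGb fun j => measure_mono inter_subset_right]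
    refine tsum_congr fun j => tsum_congr fun i => ?_
    rw [Measure.smul_apply, ← prod_univ, Measure.prod_prod, Measure.restrict_apply hs,
      Measure.restrict_apply .univ, univ_inter, smul_eq_mul]
  · ext s hs
    rw [Measure.map_apply measurable_snd hs, Measure.sum_apply _ (measurable_snd hs),
      ENNReal.tsum_prod', ENNReal.tsum_comm, ← htot ν' s hs,
      ← tsum_transport_mul (fun i => measure_ne_top ν (Q i)) (fun j => measure_ne_top ν' (Q j))
        (fun j i => hle1 i j) hGa fun j => measure_mono inter_subset_right]
    refine tsum_congr fun j => tsum_congr fun i => ?_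
    rw [Measure.smul_apply, ← univ_prod, Measure.prod_prod, Measure.restrict_apply hs,
      Measure.restrict_apply .univ, univ_inter, smul_eq_mul, mul_comm (ν (Q i)),
      mul_comm (ν (Q i))]
  · rw [Measure.ae_sum_iff]
    rintro ⟨j, i⟩
    by_cases hi : i ∈ nb j
    · refine Measure.ae_smul_measure ?_ _
      rw [Measure.prod_restrict]
      filter_upwards [ae_restrict_mem ((hQm j).prod (hQm i))] with z hz
      have h1 : c z.1 = j := hz.1
      have h2 : c z.2 = i := hz.2
      rwa [h1, h2]
    · simp [G, hgnb j i hi]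

theorem wasserstein_le_of_coupling {q : ℝ} (hq : 1 ≤ q) {ν ν' : Measure (Space n)}
    {γ : Measure (Space n × Space n)} (h1 : γ.map Prod.fst = ν) (h2 : γ.map Prod.snd = ν')
    {r : ℝ} (h : ∀ᵐ z ∂γ, dist z.1 z.2 ≤ r) :
    wasserstein q ν ν' ≤ ν univ ^ (1 / q) * ENNReal.ofReal r := by
  have hq0 : 0 < q := by linarith
  have hm : γ univ = ν univ := by
    rw [← h1, Measure.map_apply measurable_fst .univ, preimage_univ]
  calc wasserstein q ν ν' ≤ (∫⁻ z, edist z.1 z.2 ^ q ∂γ) ^ (1 / q) :=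
        ENNReal.rpow_le_rpow (iInf₂_le γ ⟨h1, h2⟩) (by positivity)
    _ ≤ (∫⁻ _, ENNReal.ofReal r ^ q ∂γ) ^ (1 / q) := by
        refine ENNReal.rpow_le_rpow (lintegral_mono_ae ?_) (by positivity)
        filter_upwards [h] with z hz
        rw [edist_dist]
        gcongr
    _ = _ := by
        rw [lintegral_const, hm, ENNReal.mul_rpow_of_nonneg _ _ (by positivity), ← ENNReal.rpow_mul,
          mul_one_div_cancel hq0.ne', ENNReal.rpow_one, mul_comm]

/-- The cell of the cubic lattice of mesh size `h` which contains `x`. -/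
def latticeCell (h : ℝ) (x : Space n) : Fin n → ℤ := fun k => ⌊x k / h⌋

theorem measurableSet_preimage_latticeCell (h : ℝ) (s : Set (Fin n → ℤ)) :
    MeasurableSet (latticeCell h ⁻¹' s) := by
  have : Measurable (latticeCell h : Space n → Fin n → ℤ) :=
    measurable_pi_lambda _ fun k => Int.measurable_floor.comp (by fun_prop)
  exact this (Set.to_countable s).measurableSet

theorem dist_le_of_latticeCell_eq {h : ℝ} (hh : 0 < h) {x y : Space n}
    (hxy : latticeCell h x = latticeCell h y) : dist x y ≤ n * h := by
  have hk : ∀ k, dist (x k) (y k) ^ 2 ≤ h ^ 2 := by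
    intro k
    have h1 := Int.abs_sub_lt_one_of_floor_eq_floor (congrFun hxy k)
    rw [← sub_div, abs_div, abs_of_pos hh, div_lt_one hh] at h1
    rw [Real.dist_eq]
    gcongr
  rw [EuclideanSpace.dist_eq]
  refine Real.sqrt_le_iff.2 ⟨by positivity, ?_⟩
  calc ∑ k, dist (x k) (y k) ^ 2 ≤ ∑ _k : Fin n, h ^ 2 := Finset.sum_le_sum fun k _ => hk k
    _ = n * h ^ 2 := by simp
    _ ≤ (n : ℝ) ^ 2 * h ^ 2 := by
      gcongr
      exact_mod_cast Nat.le_self_pow (by norm_num) n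
    _ = _ := by ring

theorem finite_image_latticeCell {h : ℝ} (hh : 0 < h) {s : Set (Space n)}
    (hs : Bornology.IsBounded s) : (latticeCell h '' s).Finite := by
  obtain ⟨C, hC⟩ := hs.exists_norm_le
  refine (Set.finite_Icc (fun _ => ⌊-C / h⌋ : Fin n → ℤ) (fun _ => ⌊C / h⌋)).subset ?_
  rintro _ ⟨x, hx, rfl⟩
  have hk : ∀ k, |x k| ≤ C := fun k => (PiLp.norm_apply_le x k).trans (hC x hx)
  refine ⟨fun k => ?_, fun k => ?_⟩ <;>
  · refine Int.floor_le_floor ?_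
    gcongr
    first | exact (abs_le.1 (hk k)).1 | exact (abs_le.1 (hk k)).2

/-- A Strassen type theorem: if `ν A` is at most the `ν'`-measure of the closed
`r`-neighbourhood of `A` for all compact `A`, then mass has to be moved at most by `r`. -/
theorem wasserstein_le_of_forall_isCompact {q : ℝ} (hq : 1 ≤ q) {ν ν' : Measure (Space n)}
    [IsFiniteMeasure ν] [IsFiniteMeasure ν'] (hmass : ν univ = ν' univ) {r : ℝ} (hr : 0 ≤ r)
    (H : ∀ ε > 0, ∀ A : Set (Space n), IsCompact A → ν A ≤ ν' (Metric.cthickening (r + ε) A)) :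
    wasserstein q ν ν' ≤ ν univ ^ (1 / q) * ENNReal.ofReal r := by
  have key : ∀ h > 0, wasserstein q ν ν' ≤
      ν univ ^ (1 / q) * ENNReal.ofReal (r + 2 * h + 2 * (n * h)) := by
    intro h hh
    set c : Space n → Fin n → ℤ := latticeCell h
    have hbdd : ∀ J : Finset (Fin n → ℤ), Bornology.IsBounded (c ⁻¹' J) := by
      intro J
      have : c ⁻¹' J = ⋃ j ∈ J, c ⁻¹' {j} := by ext; simp
      rw [this, Bornology.isBounded_biUnion_finset]
      exact fun j _ => Metric.isBounded_iff.2
        ⟨n * h, fun x hx y hy => dist_le_of_latticeCell_eq hh (hx.trans hy.symm)⟩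
    -- The neighbours of a cell are the cells it meets within distance `r + 2 * h`: one `h` is the
    -- slack `ε` in `H`, the other pays for passing to the closure of a union of cells.
    have hfin : ∀ j, {i | ∃ x y, c x = j ∧ c y = i ∧ dist y x ≤ r + 2 * h}.Finite := by
      intro j
      refine (finite_image_latticeCell hh
        ((hbdd {j}).cthickening (δ := r + 2 * h))).subset ?_
      rintro _ ⟨x, y, hx, rfl, hxy⟩
      exact ⟨y, Metric.mem_cthickening_of_dist_le y x _ _ (by simpa using hx) hxy, rfl⟩
    obtain ⟨γ, h1, h2, h3⟩ := exists_coupling_of_hall (measurableSet_preimage_latticeCell h) ν ν'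
      hmass (fun j => (hfin j).toFinset) (fun J => by
        have hA : IsCompact (closure (c ⁻¹' (J : Set (Fin n → ℤ)))) := (hbdd J).isCompact_closure
        refine (measure_mono subset_closure).trans ((H h hh _ hA).trans (measure_mono ?_))
        rw [hA.cthickening_eq_biUnion_closedBall (by positivity)]
        intro y hy
        simp only [mem_iUnion, Metric.mem_closedBall, exists_prop] at hy
        obtain ⟨z, hz, hyz⟩ := hy
        obtain ⟨x, hx, hzx⟩ := Metric.mem_closure_iff.1 hz h hh
        simp only [mem_preimage, Finset.mem_coe, Finset.mem_biUnion, Finite.mem_toFinset,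
          mem_ofPred_eq]
        refine ⟨c x, hx, x, y, rfl, rfl, ?_⟩
        linarith [dist_triangle y z x])
    refine wasserstein_le_of_coupling hq h1 h2 ?_
    filter_upwards [h3] with z hz
    simp only [Finite.mem_toFinset, mem_ofPred_eq] at hz
    obtain ⟨x, y, hx, hy, hxy⟩ := hz
    have e1 := dist_le_of_latticeCell_eq hh hx.symm
    have e2 := dist_le_of_latticeCell_eq hh hy
    have e3 := dist_triangle4 z.1 x y z.2
    rw [dist_comm x y] at e3
    linarith
  -- `wasserstein` is an infimum, so letting the mesh size tend to zero requires no limit of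
  -- couplings.
  have hlim : Tendsto (fun h : ℝ => ν univ ^ (1 / q) *
      ENNReal.ofReal (r + 2 * h + 2 * (n * h))) (𝓝[>] 0)
      (𝓝 (ν univ ^ (1 / q) * ENNReal.ofReal r)) := by
    refine ENNReal.Tendsto.const_mul (ENNReal.tendsto_ofReal ?_)
      (.inr (ENNReal.rpow_ne_top_of_nonneg (by positivity) (measure_ne_top _ _)))
    have : Continuous fun h : ℝ => r + 2 * h + 2 * (n * h) := by fun_prop
    simpa using (this.tendsto 0).mono_left nhdsWithin_le_nhds
  exact ge_of_tendsto hlim (eventually_mem_nhdsWithin.mono key)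

/-! ### Calculus of the neighbourhood relation -/

/-- `ν A` is at most the `ν'`-measure of every closed neighbourhood of `A` of radius larger
than `r`: by Strassen's theorem, the `∞`-Wasserstein distance is at most `r`. -/
def Nearby (r : ℝ) (ν ν' : Measure (Space n)) : Prop :=
  ∀ ε > 0, ∀ A : Set (Space n), IsCompact A → ν A ≤ ν' (Metric.cthickening (r + ε) A)

theorem Nearby.mono {r r' : ℝ} {ν ν' : Measure (Space n)} (h : Nearby r ν ν') (hr : r ≤ r') :
    Nearby r' ν ν' := fun ε hε A hA =>
  (h ε hε A hA).trans (measure_mono (Metric.cthickening_mono (by linarith) A))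

theorem Nearby.trans {r r' : ℝ} (hr : 0 ≤ r) (hr' : 0 ≤ r') {ν₁ ν₂ ν₃ : Measure (Space n)}
    (h : Nearby r ν₁ ν₂) (h' : Nearby r' ν₂ ν₃) : Nearby (r + r') ν₁ ν₃ := by
  intro ε hε A hA
  refine (h (ε / 2) (half_pos hε) A hA).trans ((h' (ε / 2) (half_pos hε) _ hA.cthickening).trans
    (measure_mono ?_))
  refine (Metric.cthickening_cthickening_subset (by positivity) (by positivity) A).trans
    (Metric.cthickening_mono (by linarith) A)

theorem Nearby.of_forall_lt {r : ℝ} {ν ν' : Measure (Space n)}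
    (h : ∀ r' > r, Nearby r' ν ν') : Nearby r ν ν' := by
  intro ε hε A hA
  convert! h (r + ε / 2) (by linarith) (ε / 2) (half_pos hε) A hA using 3
  ring

theorem Nearby.le_of_isClosed {r : ℝ} {ν ν' : Measure (Space n)} [IsFiniteMeasure ν]
    (h : Nearby r ν ν') {ε : ℝ} (hε : 0 < ε) {A : Set (Space n)} (hA : IsClosed A) :
    ν A ≤ ν' (Metric.cthickening (r + ε) A) := by
  rw [hA.measurableSet.measure_eq_iSup_isCompact_of_ne_top (measure_ne_top ν A)]
  refine iSup₂_le fun K hK => iSup_le fun hKc => (h ε hε K hKc).trans (measure_mono ?_)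
  exact Metric.cthickening_subset_of_subset _ hK

/-- Pass to complements: points close to the complement of a neighbourhood of `A` lie outside `A`,
and for equal finite masses an inequality between complements reverses. -/
theorem Nearby.symm {r : ℝ} (hr : 0 ≤ r) {ν ν' : Measure (Space n)} [IsFiniteMeasure ν]
    [IsFiniteMeasure ν'] (hmass : ν univ = ν' univ) (h : Nearby r ν ν') : Nearby r ν' ν := by
  intro ε hε A hA
  set U := Metric.thickening (r + ε) A
  have hU : IsOpen U := Metric.isOpen_thickening
  have h1 := h.le_of_isClosed (half_pos hε) hU.isClosed_compl
  have h2 : Metric.cthickening (r + ε / 2) Uᶜ ⊆ Aᶜ := by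
    intro x hx hxA
    obtain ⟨y, hy, hxy⟩ := (Metric.mem_thickening_iff (δ := r + ε) (E := Uᶜ)).1
      (Metric.cthickening_subset_thickening' (by positivity) (by linarith) _ hx)
    exact hy (Metric.mem_thickening_iff.2 ⟨x, hxA, by rwa [dist_comm]⟩)
  have h3 : ν Uᶜ ≤ ν' Aᶜ := h1.trans (measure_mono h2)
  refine le_trans ?_ (measure_mono (Metric.thickening_subset_cthickening _ A))
  have h4 := measure_add_measure_compl (μ := ν) hU.measurableSet
  have h5 := measure_add_measure_compl (μ := ν') hA.measurableSet
  rw [hmass, ← h5] at h4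
  refine (ENNReal.add_le_add_iff_right (measure_ne_top ν' Aᶜ)).1 ?_
  rw [← h4]
  gcongr

/-- The portmanteau theorem for closed sets; this is why the relation uses closed neighbourhoods. -/
theorem Nearby.of_tendsto {ι : Type*} {L : Filter ι} [L.NeBot] {ν : ι → FiniteMeasure (Space n)}
    {ν₀ : Measure (Space n)} {ν' : FiniteMeasure (Space n)} (hν : Tendsto ν L (𝓝 ν')) {ρ : ι → ℝ}
    {r : ℝ} (hρ : Tendsto ρ L (𝓝 r)) (h : ∀ᶠ i in L, Nearby (ρ i) ν₀ (ν i)) :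
    Nearby r ν₀ ν' := by
  intro ε hε A hA
  have hcl : IsClosed (Metric.cthickening (r + ε) A) := Metric.isClosed_cthickening
  refine le_trans ?_ (FiniteMeasure.limsup_measure_closed_le_of_tendsto hν hcl)
  refine le_trans ?_ (liminf_le_limsup (by isBoundedDefault) (by isBoundedDefault))
  refine le_liminf_of_le (by isBoundedDefault) ?_
  filter_upwards [h, hρ.eventually_lt_const (show r < r + ε / 2 by linarith)] with i hi hρi
  refine (hi (ε / 2) (half_pos hε) A hA).trans (measure_mono ?_)
  exact Metric.cthickening_mono (by linarith) A

/-! ### Limits of the curve at exceptional times -/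

/-- A family of measures whose `∞`-Wasserstein distances are controlled by a continuous function
has a limit point at every limit time. -/
theorem exists_limit_measure {E : Set ℝ} {ν : ℝ → FiniteMeasure (Space n)} {R : ℝ → ℝ}
    {M : ℝ≥0∞} (hM : ∀ s ∈ E, (ν s : Measure (Space n)) univ = M)
    (hν : ∀ s ∈ E, ∀ s' ∈ E, Nearby |R s - R s'| (ν s : Measure (Space n)) (ν s'))
    {t : ℝ} (ht : t ∈ closure E) (hR : ContinuousWithinAt R E t) :
    ∃ ν' : FiniteMeasure (Space n), (ν' : Measure (Space n)) univ = M ∧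
      ∀ s ∈ E, Nearby |R s - R t| (ν s : Measure (Space n)) ν' := by
  have : (𝓝[E] t).NeBot := mem_closure_iff_nhdsWithin_neBot.1 ht
  obtain ⟨s₀, hs₀⟩ : E.Nonempty := closure_nonempty_iff.1 ⟨t, ht⟩
  set b : ℝ := |R s₀ - R t| + 1
  have hb0 : 0 ≤ b := by positivity
  have hb : ∀ᶠ s in 𝓝[E] t, |R s₀ - R s| ≤ b := by
    have : Tendsto (fun s => |R s₀ - R s|) (𝓝[E] t) (𝓝 |R s₀ - R t|) :=
      (tendsto_const_nhds.sub hR).abs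
    exact (this.eventually_lt_const (lt_add_one _)).mono fun s hs => hs.le
  have hu : Tendsto (fun j : ℕ => ((j : NNReal) + 1)⁻¹) atTop (𝓝 0) := by
    rw [← NNReal.tendsto_coe]
    simpa using tendsto_one_div_add_atTop_nhds_zero_nat (𝕜 := ℝ)
  have hK : ∀ j : ℕ, ∃ K : Set (Space n), IsCompact K ∧
      (ν s₀ : Measure (Space n)) Kᶜ ≤ (((j : NNReal) + 1)⁻¹ : NNReal) := by
    intro j
    obtain ⟨K, -, hK, hlt⟩ := MeasurableSet.univ.exists_isCompact_sdiff_lt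
      (measure_ne_top (ν s₀ : Measure (Space n)) univ)
      (ε := (((j : NNReal) + 1)⁻¹ : NNReal)) (by simp)
    exact ⟨K, hK, by rw [compl_eq_univ_sdiff]; exact hlt.le⟩
  choose K hKc hK using hK
  -- Prokhorov's theorem: enlarging compact sets that carry almost all of `ν s₀` by `b + 1` gives
  -- uniform tightness for all `s` near `t`. The extra `1` is the `ε` in `Nearby`.
  have hcompact := isCompact_setOfPred_finiteMeasure_mass_eq_compl_isCompact_le (E := Space n)
    (ν s₀).mass hu (fun j => (hKc j).cthickening (r := b + 1)) (.inl inferInstance)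
  set U := Ultrafilter.of (𝓝[E] t)
  have hU : (U : Filter ℝ) ≤ 𝓝[E] t := Ultrafilter.of_le _
  have hmem : ∀ s ∈ E, |R s₀ - R s| ≤ b → ν s ∈ {μ : FiniteMeasure (Space n) |
      μ.mass = (ν s₀).mass ∧ ∀ j, μ (Metric.cthickening (b + 1) (K j))ᶜ ≤ ((j : NNReal) + 1)⁻¹} := by
    intro s hs hsb
    have hmass : (ν s : Measure (Space n)) univ = (ν s₀ : Measure (Space n)) univ := by
      rw [hM s hs, hM s₀ hs₀]
    refine ⟨?_, fun j => ?_⟩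
    · rw [← ENNReal.coe_inj, FiniteMeasure.ennreal_mass, FiniteMeasure.ennreal_mass, hmass]
    rw [← ENNReal.coe_le_coe, FiniteMeasure.ennreal_coeFn_eq_coeFn_toMeasure]
    refine le_trans ?_ (hK j)
    have h1 := ((hν s₀ hs₀ s hs).mono hsb) 1 one_pos (K j) (hKc j)
    rw [measure_compl Metric.isClosed_cthickening.measurableSet (measure_ne_top _ _),
      measure_compl (hKc j).measurableSet (measure_ne_top _ _), hmass]
    exact tsub_le_tsub_left h1 _
  obtain ⟨ν', ⟨hν'M, -⟩, hlim⟩ := hcompact.ultrafilter_le_nhds (U.map ν) (by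
    rw [Filter.le_principal_iff]
    refine Filter.mem_map.2 (Filter.mem_of_superset (hU (Filter.inter_mem hb self_mem_nhdsWithin))
      fun s hs => hmem s hs.2 hs.1))
  refine ⟨ν', ?_, fun s hs => ?_⟩
  · rw [← FiniteMeasure.ennreal_mass, hν'M, FiniteMeasure.ennreal_mass, hM s₀ hs₀]
  · refine Nearby.of_tendsto (L := (U : Filter ℝ)) (ν := ν) (ρ := fun s' => |R s - R s'|)
      (show Tendsto ν U (𝓝 ν') from hlim)
      (((tendsto_const_nhds.sub hR).abs).mono_left hU) ?_
    exact hU (Filter.mem_of_superset self_mem_nhdsWithin fun s' hs' => hν s hs s' hs')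

theorem eq_of_forall_isCompact_eq {ν ν' : Measure (Space n)} [IsFiniteMeasureOnCompacts ν]
    [IsFiniteMeasureOnCompacts ν'] (h : ∀ K, IsCompact K → ν K = ν' K) : ν = ν' := by
  have : IsLocallyFiniteMeasure ν := isLocallyFiniteMeasure_of_isFiniteMeasureOnCompacts
  have : IsLocallyFiniteMeasure ν' := isLocallyFiniteMeasure_of_isFiniteMeasureOnCompacts
  apply Measure.OuterRegular.ext_isOpen
  exact fun U hU => Measure.InnerRegularWRT.eq_of_innerRegularWRT_of_forall_eq
    Measure.Regular.innerRegular Measure.Regular.innerRegular h hU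

/-- If the density is continuous in time and space, the limit measure has this density. -/
theorem eq_densityMeasure_of_nearby {u : ℝ → Space n → ℝ} {O : Set ℝ} (hO : IsOpen O)
    (hu : ContinuousOn (fun z : ℝ × Space n => u z.1 z.2) (O ×ˢ univ)) {t : ℝ} (ht : t ∈ O)
    {E : Set ℝ} (htE : t ∈ closure E) {ν : Measure (Space n)} [IsFiniteMeasure ν] {ρ : ℝ → ℝ}
    (hρ : Tendsto ρ (𝓝[E] t) (𝓝 0)) (h : ∀ s ∈ E, Nearby (ρ s) ν (densityMeasure (u s)))
    (h' : ∀ s ∈ E, Nearby (ρ s) (densityMeasure (u s)) ν) : ν = densityMeasure (u t) := by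
  have : (𝓝[E] t).NeBot := mem_closure_iff_nhdsWithin_neBot.1 htE
  have hcont : ∀ s ∈ O, Continuous (u s) := fun s hs =>
    hu.comp_continuous (continuous_const.prodMk continuous_id) fun x => ⟨hs, mem_univ _⟩
  obtain ⟨δ, hδ, hδO⟩ := Metric.nhds_basis_closedBall.mem_iff.1 (hO.mem_nhds ht)
  have hOE : ∀ᶠ s in 𝓝[E] t, s ∈ Metric.closedBall t δ :=
    nhdsWithin_le_nhds (Metric.closedBall_mem_nhds t hδ)
  -- Local boundedness gives convergence of the mass of every fixed compact set. Both inequalities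
  -- below follow by letting first `s → t` and then the thickening shrink.
  have hlim : ∀ A : Set (Space n), IsCompact A →
      Tendsto (fun s => densityMeasure (u s) A) (𝓝[E] t) (𝓝 (densityMeasure (u t) A)) := by
    intro A hA
    obtain ⟨b, hb⟩ := ((isCompact_closedBall t δ).prod hA).exists_bound_of_continuousOn
      (hu.mono (prod_mono hδO (subset_univ _)))
    simp only [densityMeasure, withDensity_apply _ hA.measurableSet]
    refine tendsto_lintegral_filter_of_dominated_convergence (fun _ => ENNReal.ofReal b) ?_ ?_ ?_ ?_
    · filter_upwards [hOE] with s hs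
      exact (hcont s (hδO hs)).measurable.ennreal_ofReal
    · filter_upwards [hOE] with s hs
      filter_upwards [ae_restrict_mem hA.measurableSet] with x hx
      exact ENNReal.ofReal_le_ofReal ((le_abs_self _).trans (hb (s, x) ⟨hs, hx⟩))
    · rw [lintegral_const, Measure.restrict_apply_univ]
      exact ENNReal.mul_ne_top ENNReal.ofReal_ne_top (hA.measure_lt_top (μ := volume)).ne
    · refine .of_forall fun x => ENNReal.tendsto_ofReal ?_
      have hc : ContinuousAt (fun z : ℝ × Space n => u z.1 z.2) (t, x) :=
        hu.continuousAt ((hO.prod isOpen_univ).mem_nhds ⟨ht, mem_univ _⟩)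
      exact (hc.tendsto.comp (Continuous.prodMk continuous_id continuous_const).continuousAt).mono_left
        nhdsWithin_le_nhds
  have hfin : IsFiniteMeasureOnCompacts (densityMeasure (u t)) := by
    refine ⟨fun A hA => ?_⟩
    rw [densityMeasure, withDensity_apply _ hA.measurableSet]
    have hi : IntegrableOn (u t) A := (hcont t ht).continuousOn.integrableOn_compact hA
    exact hi.lintegral_lt_top
  refine eq_of_forall_isCompact_eq fun A hA => le_antisymm ?_ ?_
  · refine ge_of_tendsto ((tendsto_measure_cthickening_of_isCompact hA).mono_left
      (nhdsWithin_le_nhds (s := Ioi (0 : ℝ)))) ?_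
    filter_upwards [self_mem_nhdsWithin] with ε (hε : 0 < ε)
    refine ge_of_tendsto (hlim _ hA.cthickening) ?_
    filter_upwards [self_mem_nhdsWithin, hρ.eventually_lt_const (half_pos hε)] with s hs hsρ
    exact (h s hs (ε / 2) (half_pos hε) A hA).trans
      (measure_mono (Metric.cthickening_mono (by linarith) A))
  · refine ge_of_tendsto ((tendsto_measure_cthickening_of_isCompact hA).mono_left
      (nhdsWithin_le_nhds (s := Ioi (0 : ℝ)))) ?_
    filter_upwards [self_mem_nhdsWithin] with ε (hε : 0 < ε)
    refine le_of_tendsto (hlim _ hA) ?_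
    filter_upwards [self_mem_nhdsWithin, hρ.eventually_lt_const (half_pos hε)] with s hs hsρ
    exact (h' s hs (ε / 2) (half_pos hε) A hA).trans
      (measure_mono (Metric.cthickening_mono (by linarith) A))

/-! ### Test functions that detect the neighbourhood relation -/

/-- The distance to a nonempty set can be approximated uniformly by a smooth function whose
gradient has norm at most one. -/
theorem exists_smooth_approx_infDist {A : Set (Space n)} {δ : ℝ} (hδ : 0 < δ) :
    ∃ d : Space n → ℝ, ContDiff ℝ 1 d ∧ (∀ x, ‖fderiv ℝ d x‖ ≤ 1) ∧
      ∀ x, |d x - Metric.infDist x A| ≤ δ := by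
  let φ : ContDiffBump (0 : Space n) := ⟨δ / 2, δ, half_pos hδ, half_lt_self hδ⟩
  have hlip : LipschitzWith 1 fun x : Space n => Metric.infDist x A := Metric.lipschitz_infDist_pt A
  have hloc : LocallyIntegrable (fun x : Space n => Metric.infDist x A) :=
    hlip.continuous.locallyIntegrable
  set d : Space n → ℝ := MeasureTheory.convolution (φ.normed volume) (fun x => Metric.infDist x A)
    (ContinuousLinearMap.lsmul ℝ ℝ) volume
  have hex : ConvolutionExists (φ.normed volume) (fun x : Space n => Metric.infDist x A)
      (ContinuousLinearMap.lsmul ℝ ℝ) volume :=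
    φ.hasCompactSupport_normed.convolutionExists_left _ φ.continuous_normed hloc
  refine ⟨d, φ.hasCompactSupport_normed.contDiff_convolution_left _ φ.contDiff_normed hloc,
    fun x => ?_, fun x => ?_⟩
  · refine (norm_fderiv_le_of_lipschitz ℝ (C := 1) ?_).trans_eq (by simp)
    refine LipschitzWith.of_dist_le_mul fun x y => ?_
    have hi : ∀ x, Integrable fun t => φ.normed volume t * Metric.infDist (x - t) A := fun x => hex x
    have hdx : ∀ x, d x = ∫ t, φ.normed volume t * Metric.infDist (x - t) A := fun x => rfl
    rw [Real.dist_eq, hdx, hdx, ← integral_sub (hi x) (hi y), ← Real.norm_eq_abs]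
    refine (norm_integral_le_of_norm_le (φ.integrable_normed.mul_const (dist x y))
      (.of_forall fun t => ?_)).trans_eq ?_
    · rw [← mul_sub, norm_mul, Real.norm_of_nonneg (φ.nonneg_normed t)]
      gcongr
      · exact φ.nonneg_normed t
      · have := hlip.dist_le_mul (x - t) (y - t)
        simpa [Real.dist_eq] using this
    · rw [integral_mul_const, φ.integral_normed]
      simp
  · rw [← Real.dist_eq]
    refine φ.dist_normed_convolution_le hlip.continuous.aestronglyMeasurable fun y hy => ?_
    have := hlip.dist_le_mul y x
    rw [NNReal.coe_one, one_mul] at this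
    exact this.trans (Metric.mem_ball.1 hy).le

/-- A smooth nonincreasing cutoff function. -/
theorem exists_smooth_antitone_cutoff {δ : ℝ} (hδ : 0 < δ) :
    ∃ (g : ℝ → ℝ) (L : ℝ), ContDiff ℝ 1 g ∧ (∀ s, deriv g s ≤ 0) ∧ (∀ s, -L ≤ deriv g s) ∧
      (∀ s, 0 ≤ g s) ∧ (∀ s, g s ≤ 1) ∧ (∀ s ≤ 0, g s = 1) ∧ ∀ s, δ ≤ s → g s = 0 := by
  set g : ℝ → ℝ := fun s => 1 - Real.smoothTransition (s / δ)
  have hg : ContDiff ℝ 1 g := contDiff_const.sub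
    (Real.smoothTransition.contDiff.comp (contDiff_id.div_const δ))
  have hanti : Antitone g := fun a b hab =>
    sub_le_sub_left (Real.smoothTransition.monotone (div_le_div_of_nonneg_right hab hδ.le)) 1
  have hone : ∀ s ≤ 0, g s = 1 := fun s hs => by
    simp [g, Real.smoothTransition.zero_of_nonpos (div_nonpos_of_nonpos_of_nonneg hs hδ.le)]
  have hzero : ∀ s, δ ≤ s → g s = 0 := fun s hs => by
    simp [g, Real.smoothTransition.one_of_one_le ((one_le_div hδ).2 hs)]
  have hdneg : ∀ s, deriv g s ≤ 0 := fun s => hanti.deriv_nonpos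
  obtain ⟨b, hb⟩ := (isCompact_Icc (a := 0) (b := δ)).exists_bound_of_continuousOn
    (hg.continuous_deriv le_rfl).continuousOn
  refine ⟨g, max b 0, hg, hdneg, fun s => ?_,
    fun s => sub_nonneg.2 (Real.smoothTransition.le_one _),
    fun s => sub_le_self _ (Real.smoothTransition.nonneg _), hone, hzero⟩
  by_cases hs : s ∈ Icc 0 δ
  · have := hb s hs
    rw [Real.norm_eq_abs] at this
    linarith [neg_abs_le (deriv g s), le_max_left b 0]
  · have : deriv g s = 0 := by
      rw [mem_Icc, not_and_or, not_le, not_le] at hs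
      rcases hs with hs | hs
      · have : g =ᶠ[𝓝 s] fun _ => 1 := by
          filter_upwards [Iio_mem_nhds hs] with y hy using hone y (le_of_lt hy)
        simp [this.deriv_eq]
      · have : g =ᶠ[𝓝 s] fun _ => 0 := by
          filter_upwards [Ioi_mem_nhds hs] with y hy using hzero y (le_of_lt hy)
        simp [this.deriv_eq]
    simp [this]

/-- The `∞`-Wasserstein distance is controlled by a countable family of test functions. -/
theorem nearby_of_integral_le {ν ν' : Measure (Space n)} [IsFiniteMeasure ν] [IsFiniteMeasure ν']
    {A : ℕ → TopologicalSpace.NonemptyCompacts (Space n)} (hA : DenseRange A)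
    {d : ℕ → ℕ → Space n → ℝ} (hdc : ∀ k N, Continuous (d k N))
    (hd : ∀ k N x, |d k N x - Metric.infDist x (A k)| ≤ 1 / ((N : ℝ) + 1))
    {g : ℕ → ℝ → ℝ} (hgc : ∀ N, Continuous (g N)) (hg0 : ∀ N s, 0 ≤ g N s)
    (hg1 : ∀ N s, g N s ≤ 1) (hgone : ∀ N, ∀ s ≤ 0, g N s = 1)
    (hgzero : ∀ (N : ℕ) (s : ℝ), 1 / ((N : ℝ) + 1) ≤ s → g N s = 0)
    {r r' : ℕ → ℝ} {R R' : ℝ} (hr : Tendsto r atTop (𝓝 R)) (hr' : ∀ m, r' m ≤ R')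
    {ε : ℕ → ℕ → ℝ} (hε : ∀ N, Tendsto (ε N) atTop (𝓝 0))
    (H : ∀ k N (l : ℚ) m, ∫ x, g N (d k N x + r' m - l) ∂ν' ≤
      (∫ x, g N (d k N x + r m - l) ∂ν) + ε N m) :
    Nearby (R' - R) ν' ν := by
  intro η hη B hB
  rcases B.eq_empty_or_nonempty with rfl | hBne
  · simp
  -- The errors add up to `7 * δ`: at most `3 * δ` from `l`, and one `δ` each from the transition of
  -- `g`, the smoothing of the distance, the replacement of `B` by `A k`, and the approximation of
  -- `R` by `r m`.
  obtain ⟨N, hN⟩ := exists_nat_one_div_lt (show 0 < η / 7 by positivity)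
  set δ : ℝ := 1 / ((N : ℝ) + 1)
  have hδ : 0 < δ := by positivity
  let B' : TopologicalSpace.NonemptyCompacts (Space n) := ⟨⟨B, hB⟩, hBne⟩
  obtain ⟨k, hk⟩ := hA.exists_dist_lt B' hδ
  have hk1 : ∀ x, Metric.infDist x (A k) ≤ Metric.infDist x B + δ := fun x => by
    have := Metric.infDist_le_infDist_add_hausdorffDist (x := x) (s := B) (t := A k)
      (edist_ne_top B' (A k))
    rw [Metric.NonemptyCompacts.dist_eq] at hk
    exact this.trans (by linarith [show Metric.hausdorffDist B (A k : Set (Space n)) < δ from hk])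
  have hk2 : ∀ x, Metric.infDist x B ≤ Metric.infDist x (A k) + δ := fun x => by
    have := Metric.infDist_le_infDist_add_hausdorffDist (x := x) (s := A k) (t := B)
      (edist_ne_top (A k) B')
    rw [dist_comm, Metric.NonemptyCompacts.dist_eq] at hk
    exact this.trans (by linarith [show Metric.hausdorffDist (A k : Set (Space n)) B < δ from hk])
  -- On `B` the smoothed distance is at most `2 * δ`, so this level makes the cutoff equal to `1`
  -- there. A rational level keeps the family countable.
  obtain ⟨l, hl1, hl2⟩ := exists_rat_btwn (show 2 * δ + R' < 3 * δ + R' by linarith)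
  set D := Metric.cthickening (R' - R + η) B
  have hD : MeasurableSet D := Metric.isClosed_cthickening.measurableSet
  have hint : ∀ (κ : Measure (Space n)) [IsFiniteMeasure κ] (c : ℝ),
      Integrable (fun x => g N (d k N x + c - l)) κ := by
    intro κ _ c
    refine Integrable.of_bound (C := 1) ((hgc N).comp (((hdc k N).add continuous_const).sub
      continuous_const)).aestronglyMeasurable (.of_forall fun x => ?_)
    rw [Real.norm_of_nonneg (hg0 N _)]
    exact hg1 N _
  have hlow : ∀ m, ν'.real B ≤ ∫ x, g N (d k N x + r' m - l) ∂ν' := by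
    intro m
    rw [← integral_indicator_one hB.measurableSet]
    refine integral_mono ((integrable_const 1).indicator hB.measurableSet) (hint ν' _) fun x => ?_
    by_cases hx : x ∉ B
    · rw [indicator_of_notMem hx]
      exact hg0 N _
    push Not at hx
    rw [hgone N]
    · simp [hx]
    have h1 := abs_le.1 (hd k N x)
    have h2 := hk1 x
    rw [Metric.infDist_zero_of_mem hx] at h2
    linarith [h1.2, hr' m]
  have hup : ∀ᶠ m in atTop, ∫ x, g N (d k N x + r m - l) ∂ν ≤ ν.real D := by
    filter_upwards [hr.eventually_const_lt (show R - δ < R by linarith)] with m hm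
    rw [← integral_indicator_one hD]
    refine integral_mono (hint ν _) ((integrable_const 1).indicator hD) fun x => ?_
    by_cases hx : x ∈ D
    · simpa [hx] using hg1 N _
    rw [indicator_of_notMem hx]
    refine (hgzero N _ ?_).le
    by_contra! hlt
    refine hx (Metric.thickening_subset_cthickening _ _
      ((Metric.mem_thickening_iff_infDist_lt hBne).2 ?_))
    have h1 := abs_le.1 (hd k N x)
    have h2 := hk2 x
    linarith [h1.1]
  have hfin : ν'.real B ≤ ν.real D := by
    refine ge_of_tendsto (by simpa using tendsto_const_nhds.add (hε N)) ?_ (b := ν'.real B)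
    filter_upwards [hup] with m hm
    exact (hlow m).trans ((H k N l m).trans (add_le_add_left hm _))
  exact (ENNReal.toReal_le_toReal (measure_ne_top _ _) (measure_ne_top _ _)).1 hfin

/-- Slicewise null sets need not form a null set without joint measurability; measurable
representatives supply it. -/
theorem ae_le_prod_of_ae_ae_le {α β : Type*} [MeasurableSpace α] [MeasurableSpace β]
    {μ : Measure α} {ν : Measure β} [SFinite ν] {f g : α × β → ℝ}
    (hf : AEStronglyMeasurable f (μ.prod ν)) (hg : AEStronglyMeasurable g (μ.prod ν))
    (h : ∀ᵐ x ∂μ, ∀ᵐ y ∂ν, f (x, y) ≤ g (x, y)) : ∀ᵐ z ∂μ.prod ν, f z ≤ g z := by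
  have h1 : ∀ᵐ z ∂μ.prod ν, hf.mk f z ≤ hg.mk g z := by
    rw [Measure.ae_prod_iff_ae_ae (measurableSet_le hf.stronglyMeasurable_mk.measurable
      hg.stronglyMeasurable_mk.measurable)]
    filter_upwards [h, Measure.ae_ae_of_ae_prod hf.ae_eq_mk, Measure.ae_ae_of_ae_prod hg.ae_eq_mk]
      with x h1 h2 h3
    filter_upwards [h1, h2, h3] with y h1 h2 h3
    rwa [← h2, ← h3]
  filter_upwards [h1, hf.ae_eq_mk, hg.ae_eq_mk] with z h1 h2 h3
  rwa [h2, h3]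

theorem integral_densityMeasure {w : Space n → ℝ} (hw : AEMeasurable w) (h0 : ∀ᵐ x, 0 ≤ w x)
    (f : Space n → ℝ) : ∫ x, f x ∂densityMeasure w = ∫ x, w x * f x := by
  rw [densityMeasure, integral_withDensity_eq_integral_toReal_smul₀ hw.ennreal_ofReal
    (.of_forall fun _ => ENNReal.ofReal_lt_top)]
  refine integral_congr_ae ?_
  filter_upwards [h0] with x hx
  rw [ENNReal.toReal_ofReal hx, smul_eq_mul]

/-! ### Conservation of mass and finite speed of propagation -/

section

variable {S : ℝ} {μ : Measure (Space n)} [IsFiniteMeasure μ]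
  {u : ℝ → Space n → ℝ} {G : ℝ → Space n → Space n}

/-- Conservation of mass. -/
theorem ae_integral_eq_mass
    (hu : Integrable (fun z : ℝ × Space n => u z.1 z.2) (cylinder n S))
    (huG : Integrable (fun z : ℝ × Space n => u z.1 z.2 • G z.1 z.2) (cylinder n S))
    (hweak : ∀ φ : ℝ × Space n → ℝ, IsTestFunction n S φ →
      (∫ z, (u z.1 z.2 * deriv (fun s : ℝ => φ (s, z.2)) z.1
          - u z.1 z.2 * fderiv ℝ (fun y : Space n => φ (z.1, y)) z.2 (G z.1 z.2)) ∂(cylinder n S))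
        + ∫ x, φ (0, x) ∂μ = 0) :
    ∀ᵐ t ∂volume.restrict (Ioo 0 S), ∫ x, u t x = μ.real univ := by
  let ψ : ContDiffBump (0 : Space n) := ⟨1, 2, one_pos, one_lt_two⟩
  have hψ : ContDiff ℝ 1 ψ := ψ.contDiff
  obtain ⟨D, hD⟩ := (hψ.continuous_fderiv (by simp)).bounded_above_of_compact_support
    (ψ.hasCompactSupport.fderiv (𝕜 := ℝ))
  set a : ℕ → ℝ := fun k => ((k : ℝ) + 1)⁻¹
  have ha : ∀ k, 0 < a k := fun k => by positivity
  have ha0 : Tendsto a atTop (𝓝 0) := by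
    simpa [a] using tendsto_one_div_add_atTop_nhds_zero_nat (𝕜 := ℝ)
  set I : ℝ := ∫ z : ℝ × Space n, ‖u z.1 z.2 • G z.1 z.2‖ ∂cylinder n S
  -- A wide spatial cutoff has gradient of order `a k`, so the flux contribution vanishes in the
  -- limit. The signs `σ = 1` and `σ = -1` give the two inequalities.
  have hmain : ∀ (σ : ℝ), |σ| = 1 → ∀ k : ℕ, ∃ E : Set ℝ,
      (∀ᵐ t ∂volume.restrict (Ioo 0 S), t ∈ E) ∧ (∀ s ∈ E, ∫ x, u s x * (σ * ψ (a k • x)) ≤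
        (∫ x, σ * ψ (a k • x) ∂μ) + a k * D * I) := by
    intro σ hσ k
    have hfd : ∀ z : ℝ × Space n, HasFDerivAt (fun z : ℝ × Space n => σ * ψ (a k • z.2))
        (σ • ((fderiv ℝ ψ (a k • z.2)).comp (a k • ContinuousLinearMap.snd ℝ ℝ (Space n)))) z := by
      intro z
      exact ((hψ.differentiable (by simp) (a k • z.2)).hasFDerivAt.comp z
        (hasFDerivAt_snd.const_smul (a k))).const_mul σ
    have := exists_ae_le_add_of_weak hu huG hweak
      (Φ := fun z => σ * ψ (a k • z.2))
      (contDiff_const.mul (hψ.comp (contDiff_snd.const_smul (a k))))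
      (isCompact_closedBall (0 : Space n) (2 * (k + 1))) (fun t ht x hx => ?_)
      (h := fun z => a k * D * ‖u z.1 z.2 • G z.1 z.2‖) (huG.norm.const_mul _) ?_ ?_
      (ε := a k * D * I) (by rw [integral_const_mul])
    · obtain ⟨E, hE, hE0, -⟩ := this
      exact ⟨E, hE, hE0⟩
    · have : ψ (a k • x) = 0 := by
        refine ψ.zero_of_le_dist ?_
        simp only [mem_closedBall_zero_iff, not_le] at hx
        rw [dist_zero_right, norm_smul, Real.norm_of_nonneg (ha k).le]
        change 2 ≤ _
        rw [inv_mul_eq_div, le_div_iff₀ (by positivity)]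
        exact hx.le
      simp [this]
    · have hD0 : 0 ≤ D := (norm_nonneg _).trans (hD 0)
      exact .of_forall fun z => by have := ha k; positivity
    · refine .of_forall fun z => ?_
      rw [(hfd z).fderiv]
      refine (le_abs_self _).trans ?_
      rw [← smul_eq_mul, ← Real.norm_eq_abs]
      simp only [smul_apply, ContinuousLinearMap.comp_apply,
        ContinuousLinearMap.coe_snd']
      rw [norm_smul, norm_smul, Real.norm_eq_abs σ, hσ, one_mul, map_smul, norm_smul, map_neg,
        norm_neg, Real.norm_of_nonneg (ha k).le, norm_smul]
      have := (fderiv ℝ ψ (a k • z.2)).le_of_opNorm_le (hD _) (G z.1 z.2)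
      calc ‖u z.1 z.2‖ * (a k * ‖fderiv ℝ ψ (a k • z.2) (G z.1 z.2)‖)
          ≤ ‖u z.1 z.2‖ * (a k * (D * ‖G z.1 z.2‖)) := by
            have := ha k
            gcongr
        _ = _ := by ring
  choose E₁ hE₁ hE₁' using hmain 1 (by simp)
  choose E₂ hE₂ hE₂' using hmain (-1) (by simp)
  have hslice : ∀ᵐ t ∂volume.restrict (Ioo 0 S), Integrable (u t) := hu.prod_right_ae
  filter_upwards [ae_all_iff.2 hE₁, ae_all_iff.2 hE₂, hslice] with t h1 h2 ht
  have hψlim : ∀ x : Space n, Tendsto (fun k => ψ (a k • x)) atTop (𝓝 1) := by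
    intro x
    have h3 : Tendsto (fun k => a k • x) atTop (𝓝 0) := by simpa using ha0.smul_const x
    have h4 := (ψ.continuous.tendsto 0).comp h3
    rwa [ψ.one_of_mem_closedBall (by simp [ψ.rIn_pos.le])] at h4
  have hlim1 : Tendsto (fun k => ∫ x, u t x * ψ (a k • x)) atTop (𝓝 (∫ x, u t x)) := by
    refine tendsto_integral_of_dominated_convergence (fun x => ‖u t x‖) (fun k => ?_) ht.norm
      (fun k => .of_forall fun x => ?_) (.of_forall fun x => ?_)
    · exact ht.aestronglyMeasurable.mul
        (ψ.continuous.comp (continuous_id.const_smul (a k))).aestronglyMeasurable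
    · rw [norm_mul, Real.norm_of_nonneg (ψ.nonneg : 0 ≤ ψ (a k • x))]
      exact mul_le_of_le_one_right (norm_nonneg _) ψ.le_one
    · simpa using (hψlim x).const_mul (u t x)
  have hlim2 : Tendsto (fun k => ∫ x, ψ (a k • x) ∂μ) atTop (𝓝 (μ.real univ)) := by
    have : μ.real univ = ∫ _, (1 : ℝ) ∂μ := by simp
    rw [this]
    refine tendsto_integral_of_dominated_convergence (fun x => 1) (fun k => ?_)
      (integrable_const _) (fun k => .of_forall fun x => ?_) (.of_forall fun x => hψlim x)
    · exact (ψ.continuous.comp (continuous_id.const_smul (a k))).aestronglyMeasurable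
    · rw [Real.norm_of_nonneg (ψ.nonneg : 0 ≤ ψ (a k • x))]
      exact ψ.le_one
  have hlim3 : Tendsto (fun k => a k * D * I) atTop (𝓝 0) := by
    simpa using (ha0.mul_const D).mul_const I
  refine le_antisymm ?_ ?_
  · refine le_of_tendsto_of_tendsto hlim1 (by simpa using hlim2.add hlim3) (.of_forall fun k => ?_)
    simpa using hE₁' k t (h1 k)
  · refine le_of_tendsto_of_tendsto hlim2 (by simpa using hlim1.add hlim3) (.of_forall fun k => ?_)
    have := hE₂' k t (h2 k)
    simp only [neg_mul, one_mul, mul_neg, integral_neg] at this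
    dsimp only
    linarith

/-- The evolution of the mass in a neighbourhood of a compact set whose radius shrinks
at speed `κ`, if the velocity is bounded by `V`. -/
theorem exists_ae_moving_cutoff
    (hu : Integrable (fun z : ℝ × Space n => u z.1 z.2) (cylinder n S))
    (hu0 : ∀ᵐ z ∂cylinder n S, 0 ≤ u z.1 z.2)
    (huG : Integrable (fun z : ℝ × Space n => u z.1 z.2 • G z.1 z.2) (cylinder n S))
    (hweak : ∀ φ : ℝ × Space n → ℝ, IsTestFunction n S φ →
      (∫ z, (u z.1 z.2 * deriv (fun s : ℝ => φ (s, z.2)) z.1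
          - u z.1 z.2 * fderiv ℝ (fun y : Space n => φ (z.1, y)) z.2 (G z.1 z.2)) ∂(cylinder n S))
        + ∫ x, φ (0, x) ∂μ = 0)
    {V κ : ℝ → ℝ} (hV : IntegrableOn V (Ioo 0 S))
    (hGV : ∀ᵐ z ∂cylinder n S, ‖u z.1 z.2 • G z.1 z.2‖ ≤ V z.1 * u z.1 z.2)
    (hκ : Continuous κ) (hκ0 : ∀ t, 0 ≤ κ t) (hκV : ∀ t ∈ Ioo 0 S, κ t ≤ V t)
    {A : Set (Space n)} (hA : IsCompact A) (hAne : A.Nonempty) {d : Space n → ℝ}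
    (hd : ContDiff ℝ 1 d) (hd1 : ∀ x, ‖fderiv ℝ d x‖ ≤ 1) {δ : ℝ}
    (hdA : ∀ x, |d x - Metric.infDist x A| ≤ δ) {g : ℝ → ℝ} {L : ℝ} (hg : ContDiff ℝ 1 g)
    (hg0 : ∀ s, deriv g s ≤ 0) (hgL : ∀ s, -L ≤ deriv g s) (hgz : ∀ s, δ ≤ s → g s = 0) (l : ℝ) :
    ∃ E : Set ℝ, (∀ᵐ t ∂volume.restrict (Ioo 0 S), t ∈ E) ∧
      (∀ s ∈ E, ∫ x, u s x * g (d x + (∫ τ in 0..s, κ τ) - l) ≤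
        (∫ x, g (d x + 0 - l) ∂μ) + L * μ.real univ * ∫ t in Ioo 0 S, (V t - κ t)) ∧
      ∀ s ∈ E, ∀ s' ∈ E, s < s' → ∫ x, u s' x * g (d x + (∫ τ in 0..s', κ τ) - l) ≤
        (∫ x, u s x * g (d x + (∫ τ in 0..s, κ τ) - l)) +
          L * μ.real univ * ∫ t in Ioo 0 S, (V t - κ t) := by
  set r : ℝ → ℝ := fun s => ∫ τ in 0..s, κ τ
  have hr : ∀ t, HasDerivAt r (κ t) t := fun t =>
    intervalIntegral.integral_hasDerivAt_right (hκ.intervalIntegrable _ _)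
      (hκ.stronglyMeasurableAtFilter _ _) hκ.continuousAt
  have hrC : ContDiff ℝ 1 r := contDiff_one_iff_deriv.2
    ⟨fun t => (hr t).differentiableAt, by rwa [funext fun t => (hr t).deriv]⟩
  have hr0 : ∀ t, 0 ≤ t → 0 ≤ r t := fun t ht =>
    intervalIntegral.integral_nonneg ht fun s _ => hκ0 s
  have hL : 0 ≤ L := by linarith [hg0 0, hgL 0]
  have hcyl : ∀ᵐ z ∂cylinder n S, z.1 ∈ Ioo 0 S :=
    Measure.quasiMeasurePreserving_fst.ae (ae_restrict_mem measurableSet_Ioo)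
  have hmass := ae_integral_eq_mass hu huG hweak
  have hVκ : IntegrableOn (fun t => V t - κ t) (Ioo 0 S) :=
    hV.sub (hκ.continuousOn.integrableOn_Icc.mono_set Ioo_subset_Icc_self)
  have hslice : ∀ᵐ t ∂volume.restrict (Ioo 0 S), Integrable (u t) := hu.prod_right_ae
  have hu0' : ∀ᵐ t ∂volume.restrict (Ioo 0 S), ∀ᵐ x, 0 ≤ u t x := Measure.ae_ae_of_ae_prod hu0
  have hhmeas : AEStronglyMeasurable (fun z : ℝ × Space n => (V z.1 - κ z.1) * u z.1 z.2)
      (cylinder n S) :=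
    (hVκ.aestronglyMeasurable.comp_fst (ν := volume)).mul hu.aestronglyMeasurable
  have hhint : Integrable (fun z : ℝ × Space n => (V z.1 - κ z.1) * u z.1 z.2) (cylinder n S) := by
    refine (integrable_prod_iff hhmeas).2 ⟨?_, ?_⟩
    · filter_upwards [hslice] with t ht using ht.const_mul _
    · refine (hVκ.norm.mul_const (μ.real univ)).congr ?_
      filter_upwards [hmass, hu0'] with t h1 h2
      simp only [norm_mul, integral_const_mul]
      rw [← h1]
      congr 1
      refine integral_congr_ae ?_
      filter_upwards [h2] with x hx
      rw [Real.norm_of_nonneg hx]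
  have hfd : ∀ z : ℝ × Space n, HasFDerivAt (fun z : ℝ × Space n => g (d z.2 + r z.1 - l))
      (deriv g (d z.2 + r z.1 - l) • ((fderiv ℝ d z.2).comp (ContinuousLinearMap.snd ℝ ℝ (Space n)) +
        κ z.1 • ContinuousLinearMap.fst ℝ ℝ (Space n))) z := by
    intro z
    have h1 : HasFDerivAt (fun z : ℝ × Space n => d z.2)
        ((fderiv ℝ d z.2).comp (ContinuousLinearMap.snd ℝ ℝ (Space n))) z :=
      (hd.differentiable (by simp) z.2).hasFDerivAt.comp z hasFDerivAt_snd
    have h2 : HasFDerivAt (fun z : ℝ × Space n => r z.1)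
        (κ z.1 • ContinuousLinearMap.fst ℝ ℝ (Space n)) z :=
      (hr z.1).comp_hasFDerivAt z hasFDerivAt_fst
    exact (hg.differentiable (by simp) _).hasDerivAt.comp_hasFDerivAt z ((h1.add h2).sub_const l)
  have hr00 : r 0 = 0 := by simp [r]
  -- The flux term is `u g' (κ - ∇d · G)`. Since `-L ≤ g' ≤ 0`, `|∇d| ≤ 1` and `κ ≤ V`, it is at
  -- most `L (V - κ) u`, and conservation of mass integrates this bound. Where the cutoff is
  -- nonzero, `d < l + δ` because `r ≥ 0`, which gives the compact set.
  have := exists_ae_le_add_of_weak hu huG hweak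
    (Φ := fun z => g (d z.2 + r z.1 - l))
    (hg.comp (((hd.comp contDiff_snd).add (hrC.comp contDiff_fst)).sub contDiff_const))
    (hA.cthickening (r := l + 2 * δ)) (fun t ht x hx => ?_)
    (h := fun z => L * ((V z.1 - κ z.1) * u z.1 z.2)) (hhint.const_mul L) ?_ ?_
    (ε := L * μ.real univ * ∫ t in Ioo 0 S, (V t - κ t)) ?_
  · simpa only [hr00] using this
  · refine hgz _ ?_
    by_contra! hlt
    refine hx (Metric.thickening_subset_cthickening _ _
      ((Metric.mem_thickening_iff_infDist_lt hAne).2 ?_))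
    have h1 := abs_le.1 (hdA x)
    have h2 := hr0 t ht
    dsimp only at hlt
    linarith [h1.1]
  · filter_upwards [hcyl, hu0] with z hz hz0
    have := hκV z.1 hz
    have : 0 ≤ V z.1 - κ z.1 := by linarith
    positivity
  · filter_upwards [hcyl, hu0, hGV] with z hz hz0 hzG
    rw [(hfd z).fderiv]
    simp only [smul_apply, add_apply, ContinuousLinearMap.comp_apply,
      ContinuousLinearMap.coe_snd', ContinuousLinearMap.coe_fst', smul_eq_mul, mul_one]
    set g' := deriv g (d z.2 + r z.1 - l)
    have hg1 : g' ≤ 0 := hg0 _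
    have hg2 : -L ≤ g' := hgL _
    have h1 : u z.1 z.2 * fderiv ℝ d z.2 (G z.1 z.2) ≤ V z.1 * u z.1 z.2 := by
      rw [← smul_eq_mul, ← map_smul]
      refine (le_abs_self _).trans (le_trans ?_ hzG)
      rw [← Real.norm_eq_abs]
      simpa using (fderiv ℝ d z.2).le_of_opNorm_le (hd1 z.2) (u z.1 z.2 • G z.1 z.2)
    have h2 : 0 ≤ (V z.1 - κ z.1) * u z.1 z.2 :=
      mul_nonneg (by linarith [hκV z.1 hz]) hz0
    rw [map_neg]
    nlinarith
  · rw [integral_const_mul, mul_assoc]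
    gcongr
    unfold cylinder at hhint ⊢
    rw [integral_prod _ hhint]
    rw [← integral_const_mul]
    refine le_of_eq (integral_congr_ae ?_)
    filter_upwards [hmass] with t ht
    rw [integral_const_mul, ht, mul_comm]

end

/-! ### The integrable speed bound and the good times -/

/-- The bound `K t ^ (1/n - 1)` for the velocity at time `t`. -/
def speedBound (n : ℕ) (K t : ℝ) : ℝ := K * t ^ (1 / (n : ℝ) - 1)

/-- The distance travelled until time `t` with maximal speed. -/
def travelBound (n : ℕ) (K t : ℝ) : ℝ := ∫ τ in 0..t, speedBound n K τ

theorem intervalIntegrable_speedBound (hn : 2 ≤ n) (K a b : ℝ) :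
    IntervalIntegrable (speedBound n K) volume a b := by
  have : (0 : ℝ) < 1 / n := by
    have : (0 : ℝ) < n := by exact_mod_cast (by omega : 0 < n)
    positivity
  exact (intervalIntegral.intervalIntegrable_rpow' (by linarith)).const_mul K

theorem integrableOn_speedBound (hn : 2 ≤ n) (K : ℝ) {S : ℝ} (hS : 0 ≤ S) :
    IntegrableOn (speedBound n K) (Ioo 0 S) :=
  ((intervalIntegrable_iff_integrableOn_Ioo_of_le hS).1 (intervalIntegrable_speedBound hn K 0 S))

theorem speedBound_nonneg {K : ℝ} (hK : 0 ≤ K) {t : ℝ} (ht : 0 ≤ t) : 0 ≤ speedBound n K t :=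
  mul_nonneg hK (Real.rpow_nonneg ht _)

theorem speedBound_anti (hn : 2 ≤ n) {K : ℝ} (hK : 0 ≤ K) {s t : ℝ} (hs : 0 < s) (hst : s ≤ t) :
    speedBound n K t ≤ speedBound n K s := by
  refine mul_le_mul_of_nonneg_left (Real.rpow_le_rpow_of_nonpos hs hst ?_) hK
  have : (1 : ℝ) ≤ n := by exact_mod_cast (by omega : 1 ≤ n)
  rw [sub_nonpos, div_le_one (by linarith)]
  exact this

theorem continuous_travelBound (hn : 2 ≤ n) (K : ℝ) : Continuous (travelBound n K) :=
  intervalIntegral.continuous_primitive (fun a b => intervalIntegrable_speedBound hn K a b) 0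

theorem travelBound_sub (hn : 2 ≤ n) (K s t : ℝ) :
    travelBound n K t - travelBound n K s = ∫ τ in s..t, speedBound n K τ :=
  intervalIntegral.integral_interval_sub_left (intervalIntegrable_speedBound hn K _ _)
    (intervalIntegrable_speedBound hn K _ _)

theorem travelBound_mono (hn : 2 ≤ n) {K : ℝ} (hK : 0 ≤ K) {s t : ℝ} (hs : 0 ≤ s) (hst : s ≤ t) :
    travelBound n K s ≤ travelBound n K t := by
  rw [← sub_nonneg, travelBound_sub hn]
  exact intervalIntegral.integral_nonneg hst fun τ hτ => speedBound_nonneg hK (hs.trans hτ.1)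

theorem isFiniteMeasure_densityMeasure {w : Space n → ℝ} (hw : Integrable w) :
    IsFiniteMeasure (densityMeasure w) := isFiniteMeasure_withDensity_ofReal hw.2

theorem densityMeasure_univ {w : Space n → ℝ} (hw : Integrable w) (h0 : ∀ᵐ x, 0 ≤ w x) :
    densityMeasure w univ = ENNReal.ofReal (∫ x, w x) := by
  rw [densityMeasure, withDensity_apply _ .univ, Measure.restrict_univ,
    ofReal_integral_eq_lintegral_ofReal hw h0]

section

variable {S : ℝ} {μ : Measure (Space n)}
  {u : ℝ → Space n → ℝ} {G : ℝ → Space n → Space n}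

theorem ae_norm_smul_gradient_le (hn : 2 ≤ n) {c : ℝ} (hc0 : 0 ≤ c)
    (hc : ∀ (w : Space n → ℝ), Integrable w → ∀ B : ℝ, 0 ≤ B → (∀ᵐ y, |w y| ≤ B) →
      ∀ ρ : ℝ, 0 < ρ →
      LipschitzWith (Real.toNNReal (c * (B * ρ + (ρ ^ (n - 1))⁻¹ * ∫ y, |w y|))) (pressure n w))
    (hu : Integrable (fun z : ℝ × Space n => u z.1 z.2) (cylinder n S))
    (hu0 : ∀ᵐ z ∂cylinder n S, 0 ≤ u z.1 z.2)
    (hG : ∀ᵐ t ∂(volume.restrict (Ioo 0 S)), IsWeakGradient (pressure n (u t)) (G t))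
    (huG : Integrable (fun z : ℝ × Space n => u z.1 z.2 • G z.1 z.2) (cylinder n S))
    (hmass : ∀ᵐ t ∂volume.restrict (Ioo 0 S), ∫ x, u t x = μ.real univ) {C : ℝ}
    (hC : ∀ᵐ t ∂volume.restrict (Ioo 0 S), eLpNorm (u t) ⊤ volume ≤ ENNReal.ofReal (C / t)) :
    ∀ᵐ z ∂cylinder n S, ‖u z.1 z.2 • G z.1 z.2‖ ≤
      speedBound n (c * (|C| + μ.real univ)) z.1 * u z.1 z.2 := by
  have hslice : ∀ᵐ t ∂volume.restrict (Ioo 0 S), Integrable (u t) := hu.prod_right_ae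
  have hu0' : ∀ᵐ t ∂volume.restrict (Ioo 0 S), ∀ᵐ x, 0 ≤ u t x := Measure.ae_ae_of_ae_prod hu0
  have hmeas : Measurable (speedBound n (c * (|C| + μ.real univ))) := by
    unfold speedBound; fun_prop
  refine ae_le_prod_of_ae_ae_le huG.norm.aestronglyMeasurable
    ((hmeas.comp measurable_fst).aestronglyMeasurable.mul hu.aestronglyMeasurable) ?_
  filter_upwards [hslice, hu0', hG, hmass, hC, ae_restrict_mem measurableSet_Ioo]
    with t h1 h2 h3 h4 h5 ht
  have hn0 : (0 : ℝ) < n := by exact_mod_cast (by omega : 0 < n)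
  have hB : ∀ᵐ x, |u t x| ≤ |C| / t := by
    have hess : ∀ᵐ x, ‖u t x‖ₑ ≤ eLpNorm (u t) ⊤ volume := by
      rw [eLpNorm_exponent_top]; exact enorm_ae_le_eLpNormEssSup (u t) volume
    filter_upwards [hess] with x hx
    have h6 : ENNReal.ofReal |u t x| ≤ ENNReal.ofReal (|C| / t) := by
      rw [← Real.enorm_eq_ofReal_abs]
      refine (hx.trans h5).trans (ENNReal.ofReal_le_ofReal ?_)
      have := ht.1
      gcongr
      exact le_abs_self C
    exact (ENNReal.ofReal_le_ofReal_iff (div_nonneg (abs_nonneg _) ht.1.le)).1 h6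
  -- The radius `t ^ (1 / n)` balances the near and far parts of the singular integral: both become
  -- multiples of `t ^ (1 / n - 1)`.
  have hlip := hc (u t) h1 (|C| / t) (div_nonneg (abs_nonneg _) ht.1.le) hB (t ^ (1 / (n : ℝ)))
    (Real.rpow_pos_of_pos ht.1 _)
  have habs : ∫ y, |u t y| = μ.real univ := by
    rw [← h4]
    refine integral_congr_ae ?_
    filter_upwards [h2] with x hx using abs_of_nonneg hx
  have hpow : ((t ^ (1 / (n : ℝ))) ^ (n - 1))⁻¹ = t ^ (1 / (n : ℝ) - 1) := by
    rw [← Real.rpow_natCast, ← Real.rpow_mul ht.1.le, ← Real.rpow_neg ht.1.le,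
      Nat.cast_sub (by omega)]
    congr 1
    field_simp
    push_cast
    ring
  have hpow' : |C| / t * t ^ (1 / (n : ℝ)) = |C| * t ^ (1 / (n : ℝ) - 1) := by
    rw [Real.rpow_sub_one ht.1.ne']
    ring
  have hconst : c * (|C| / t * t ^ (1 / (n : ℝ)) + ((t ^ (1 / (n : ℝ))) ^ (n - 1))⁻¹ *
      ∫ y, |u t y|) = speedBound n (c * (|C| + μ.real univ)) t := by
    rw [habs, hpow, hpow', speedBound]
    ring
  rw [hconst] at hlip
  filter_upwards [h3.ae_norm_le hlip, h2] with x hx hx0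
  rw [Real.coe_toNNReal _ (speedBound_nonneg (by positivity) ht.1.le)] at hx
  rw [norm_smul, Real.norm_of_nonneg hx0, mul_comm]
  gcongr

/-- For almost all times the densities move at most with maximal speed. -/
theorem exists_good_times [IsFiniteMeasure μ] (hn : 2 ≤ n) {K : ℝ} (hK : 0 ≤ K) (hS : 0 < S)
    (hu : Integrable (fun z : ℝ × Space n => u z.1 z.2) (cylinder n S))
    (hu0 : ∀ᵐ z ∂cylinder n S, 0 ≤ u z.1 z.2)
    (huG : Integrable (fun z : ℝ × Space n => u z.1 z.2 • G z.1 z.2) (cylinder n S))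
    (hweak : ∀ φ : ℝ × Space n → ℝ, IsTestFunction n S φ →
      (∫ z, (u z.1 z.2 * deriv (fun s : ℝ => φ (s, z.2)) z.1
          - u z.1 z.2 * fderiv ℝ (fun y : Space n => φ (z.1, y)) z.2 (G z.1 z.2)) ∂(cylinder n S))
        + ∫ x, φ (0, x) ∂μ = 0)
    (hGV : ∀ᵐ z ∂cylinder n S, ‖u z.1 z.2 • G z.1 z.2‖ ≤ speedBound n K z.1 * u z.1 z.2) :
    ∃ E : Set ℝ, (∀ᵐ t ∂volume.restrict (Ioo 0 S), t ∈ E) ∧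
      (∀ s ∈ E, IsFiniteMeasure (densityMeasure (u s)) ∧ densityMeasure (u s) univ = μ univ) ∧
      (∀ s ∈ E, Nearby (travelBound n K s) (densityMeasure (u s)) μ) ∧
      ∀ s ∈ E, ∀ s' ∈ E, s < s' → Nearby (travelBound n K s' - travelBound n K s)
        (densityMeasure (u s')) (densityMeasure (u s)) := by
  set V := speedBound n K
  have hV : IntegrableOn V (Ioo 0 S) := integrableOn_speedBound hn K hS.le
  set a : ℕ → ℝ := fun m => 1 / ((m : ℝ) + 1)
  have ha : ∀ m, 0 < a m := fun m => by positivity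
  have ha0 : Tendsto a atTop (𝓝 0) := tendsto_one_div_add_atTop_nhds_zero_nat
  -- Freezing the speed before time `a m` removes its singularity at `0`, so that the moving radius
  -- is continuously differentiable. Monotonicity of `V` keeps `κ m ≤ V`, and the loss in the
  -- integral tends to zero.
  set κ : ℕ → ℝ → ℝ := fun m t => V (max t (a m))
  have hκc : ∀ m, Continuous (κ m) := fun m =>
    continuous_const.mul ((continuous_id.max continuous_const).rpow_const fun t =>
      .inl (lt_max_of_lt_right (ha m)).ne')
  have hκ0 : ∀ m t, 0 ≤ κ m t := fun m t => speedBound_nonneg hK (le_max_of_le_right (ha m).le)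
  have hκV : ∀ m, ∀ t > 0, κ m t ≤ V t := fun m t ht => speedBound_anti hn hK ht (le_max_left _ _)
  set r : ℕ → ℝ → ℝ := fun m s => ∫ τ in 0..s, κ m τ
  have hrR : ∀ m s, 0 ≤ s → r m s ≤ travelBound n K s := fun m s hs =>
    intervalIntegral.integral_mono_on_of_le_Ioo hs ((hκc m).intervalIntegrable _ _)
      (intervalIntegrable_speedBound hn K _ _) fun t ht => hκV m t ht.1
  have hκlim : ∀ t > 0, Tendsto (fun m => κ m t) atTop (𝓝 (V t)) := by
    intro t ht
    refine tendsto_const_nhds.congr' ?_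
    filter_upwards [ha0.eventually_lt_const ht] with m hm
    simp only [κ, max_eq_left hm.le]
  have hrlim : ∀ s, 0 ≤ s → Tendsto (fun m => r m s) atTop (𝓝 (travelBound n K s)) := by
    intro s hs
    refine intervalIntegral.tendsto_integral_filter_of_dominated_convergence V
      (.of_forall fun m => (hκc m).aestronglyMeasurable) (.of_forall fun m => .of_forall fun t ht => ?_)
      (intervalIntegrable_speedBound hn K _ _) (.of_forall fun t ht => ?_)
    · rw [uIoc_of_le hs] at ht
      rw [Real.norm_of_nonneg (hκ0 m t)]
      exact hκV m t ht.1
    · rw [uIoc_of_le hs] at ht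
      exact hκlim t ht.1
  have hωlim : Tendsto (fun m => ∫ t in Ioo 0 S, (V t - κ m t)) atTop (𝓝 0) := by
    have : ∀ m, ∫ t in Ioo 0 S, (V t - κ m t) = travelBound n K S - r m S := by
      intro m
      rw [← integral_Ioc_eq_integral_Ioo, ← intervalIntegral.integral_of_le hS.le,
        intervalIntegral.integral_sub (intervalIntegrable_speedBound hn K _ _)
          ((hκc m).intervalIntegrable _ _)]
      rfl
    simp only [this]
    simpa using (hrlim S hS.le).const_sub (travelBound n K S)
  let A : ℕ → TopologicalSpace.NonemptyCompacts (Space n) :=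
    TopologicalSpace.denseSeq (TopologicalSpace.NonemptyCompacts (Space n))
  have hA : DenseRange A := TopologicalSpace.denseRange_denseSeq _
  choose d hdC hd1 hdA using fun k N : ℕ =>
    exists_smooth_approx_infDist (A := (A k : Set (Space n))) (Nat.one_div_pos_of_nat (α := ℝ) (n := N))
  choose g L hgC hgneg hgL hg0 hg1 hgone hgz using fun N : ℕ =>
    exists_smooth_antitone_cutoff (Nat.one_div_pos_of_nat (α := ℝ) (n := N))
  -- Dense compact sets, accuracies, rational levels and truncations are countably many, so their
  -- exceptional times together form a null set.
  choose E hE hEμ hEs using fun (k N : ℕ) (l : ℚ) (m : ℕ) =>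
    exists_ae_moving_cutoff hu hu0 huG hweak hV hGV (hκc m) (hκ0 m) (fun t ht => hκV m t ht.1)
      (A k).isCompact (A k).nonempty (hdC k N) (hd1 k N) (hdA k N) (hgC N) (hgneg N) (hgL N) (hgz N) l
  have hslice : ∀ᵐ t ∂volume.restrict (Ioo 0 S), Integrable (u t) := hu.prod_right_ae
  have hu0' : ∀ᵐ t ∂volume.restrict (Ioo 0 S), ∀ᵐ x, 0 ≤ u t x := Measure.ae_ae_of_ae_prod hu0
  have hmass := ae_integral_eq_mass hu huG hweak
  have hεlim : ∀ N, Tendsto (fun m => L N * μ.real univ * ∫ t in Ioo 0 S, (V t - κ m t)) atTop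
      (𝓝 0) := fun N => by simpa using hωlim.const_mul (L N * μ.real univ)
  refine ⟨{t | t ∈ Ioo 0 S ∧ Integrable (u t) ∧ (∀ᵐ x, 0 ≤ u t x) ∧ ∫ x, u t x = μ.real univ ∧
    ∀ k N l m, t ∈ E k N l m}, ?_, ?_, ?_, ?_⟩
  · have hE' : ∀ᵐ t ∂volume.restrict (Ioo 0 S), ∀ k N l m, t ∈ E k N l m := by
      simp only [ae_all_iff]
      exact hE
    filter_upwards [ae_restrict_mem measurableSet_Ioo, hslice, hu0', hmass, hE'] with t h1 h2 h3 h4 h5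
    exact ⟨h1, h2, h3, h4, h5⟩
  · rintro s ⟨-, h2, h3, h4, -⟩
    refine ⟨isFiniteMeasure_densityMeasure h2, ?_⟩
    rw [densityMeasure_univ h2 h3, h4, ofReal_measureReal]
  · rintro s ⟨h1, h2, h3, -, h5⟩
    have := isFiniteMeasure_densityMeasure h2
    have key := nearby_of_integral_le (ν := μ) (ν' := densityMeasure (u s)) hA
      (fun k N => (hdC k N).continuous) hdA (fun N => (hgC N).continuous) hg0 hg1 hgone hgz
      (r := fun _ => 0) tendsto_const_nhds (fun m => hrR m s h1.1.le) hεlim (fun k N l m => by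
        rw [integral_densityMeasure h2.aemeasurable h3]
        exact hEμ k N l m s (h5 k N l m))
    simpa using key
  · rintro s ⟨h1, h2, h3, -, h5⟩ s' ⟨h1', h2', h3', -, h5'⟩ hss
    have := isFiniteMeasure_densityMeasure h2
    have := isFiniteMeasure_densityMeasure h2'
    exact nearby_of_integral_le (ν := densityMeasure (u s)) (ν' := densityMeasure (u s')) hA
      (fun k N => (hdC k N).continuous) hdA (fun N => (hgC N).continuous) hg0 hg1 hgone hgz
      (hrlim s h1.1.le) (fun m => hrR m s' h1'.1.le) hεlim (fun k N l m => by
        rw [integral_densityMeasure h2.aemeasurable h3, integral_densityMeasure h2'.aemeasurable h3']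
        exact hEs k N l m s (h5 k N l m) s' (h5' k N l m) hss)

end

theorem exists_seq_exhausting {T : EReal} (hT : 0 < T) :
    ∃ S : ℕ → ℝ, (∀ k, 0 < S k ∧ (S k : EReal) ≤ T) ∧ ∀ t : ℝ, (t : EReal) < T → ∃ k, t < S k := by
  induction T with
  | bot => simp at hT
  | top =>
    refine ⟨fun k => k + 1, fun k => ⟨by positivity, le_top⟩, fun t _ => ?_⟩
    obtain ⟨k, hk⟩ := exists_nat_gt t
    exact ⟨k, hk.trans (lt_add_one _)⟩
  | coe T =>
    refine ⟨fun _ => T, fun _ => ⟨by exact_mod_cast hT, le_rfl⟩, fun t ht => ⟨0, ?_⟩⟩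
    exact_mod_cast ht

/-- For almost all times up to `T` the densities move at most with maximal speed. -/
theorem exists_good_times_of_isWeakSolution (hn : 2 ≤ n) {T : EReal} (hT : 0 < T)
    {μ : Measure (Space n)} [IsFiniteMeasure μ] {u : ℝ → Space n → ℝ}
    (hu : ∀ S : ℝ, 0 < S → (S : EReal) ≤ T → IsWeakSolution n S μ u) {C : ℝ}
    (hC : ∀ᵐ t : ℝ, 0 < t → (t : EReal) < T →
      eLpNorm (u t) ⊤ volume ≤ ENNReal.ofReal (C / t)) :
    ∃ K : ℝ, 0 ≤ K ∧ ∃ E : Set ℝ, (∀ᵐ t : ℝ, 0 < t → (t : EReal) < T → t ∈ E) ∧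
      (∀ s ∈ E, 0 < s ∧ (s : EReal) < T) ∧
      (∀ s ∈ E, IsFiniteMeasure (densityMeasure (u s)) ∧ densityMeasure (u s) univ = μ univ) ∧
      (∀ s ∈ E, Nearby (travelBound n K s) (densityMeasure (u s)) μ) ∧
      ∀ s ∈ E, ∀ s' ∈ E, s < s' → Nearby (travelBound n K s' - travelBound n K s)
        (densityMeasure (u s')) (densityMeasure (u s)) := by
  obtain ⟨c, hc0, hc⟩ := exists_lipschitzWith_pressure hn
  have hK : 0 ≤ c * (|C| + μ.real univ) := by positivity
  obtain ⟨S, hS, hST⟩ := exists_seq_exhausting hT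
  have hgood : ∀ k, ∃ E : Set ℝ, (∀ᵐ t ∂volume.restrict (Ioo 0 (S k)), t ∈ E) ∧
      (∀ s ∈ E, IsFiniteMeasure (densityMeasure (u s)) ∧ densityMeasure (u s) univ = μ univ) ∧
      (∀ s ∈ E, Nearby (travelBound n (c * (|C| + μ.real univ)) s) (densityMeasure (u s)) μ) ∧
      ∀ s ∈ E, ∀ s' ∈ E, s < s' → Nearby (travelBound n (c * (|C| + μ.real univ)) s' -
        travelBound n (c * (|C| + μ.real univ)) s)
        (densityMeasure (u s')) (densityMeasure (u s)) := by
    intro k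
    obtain ⟨hu0, hui, G, hG, -, huG, hweak⟩ := hu (S k) (hS k).1 (hS k).2
    refine exists_good_times hn hK (hS k).1 hui hu0 huG hweak
      (ae_norm_smul_gradient_le hn hc0 hc hui hu0 hG huG (ae_integral_eq_mass hui huG hweak) ?_)
    rw [ae_restrict_iff' measurableSet_Ioo]
    filter_upwards [hC] with t ht htS
    exact ht htS.1 ((EReal.coe_lt_coe_iff.2 htS.2).trans_le (hS k).2)
  choose E hE hE₁ hE₂ hE₃ using hgood
  -- The constant does not depend on the horizon `S k`, and membership is required for every horizon
  -- beyond `t`; two good times can thus be compared on any horizon beyond the later one.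
  refine ⟨_, hK, {t | 0 < t ∧ (t : EReal) < T ∧ ∀ k, t < S k → t ∈ E k}, ?_,
    fun s hs => ⟨hs.1, hs.2.1⟩, fun s hs => ?_, fun s hs => ?_, fun s hs s' hs' hss => ?_⟩
  · have : ∀ᵐ t : ℝ, ∀ k, t ∈ Ioo 0 (S k) → t ∈ E k :=
      ae_all_iff.2 fun k => (ae_restrict_iff' measurableSet_Ioo).1 (hE k)
    filter_upwards [this] with t ht h0 hT
    exact ⟨h0, hT, fun k hk => ht k ⟨h0, hk⟩⟩
  · obtain ⟨k, hk⟩ := hST s hs.2.1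
    exact hE₁ k s (hs.2.2 k hk)
  · obtain ⟨k, hk⟩ := hST s hs.2.1
    exact hE₂ k s (hs.2.2 k hk)
  · obtain ⟨k, hk⟩ := hST s' hs'.2.1
    exact hE₃ k s (hs.2.2 k (hss.trans hk)) s' (hs'.2.2 k hk) hss

end MeanField

end

/-! ### Construction of the curve -/

theorem lemma5p3 (n : ℕ) (hn : 2 ≤ n) (T : EReal) (hT : 0 < T)
    (μ : Measure (MeanField.Space n)) [IsFiniteMeasure μ]
    (u : ℝ → MeanField.Space n → ℝ)
    (hu : ∀ S : ℝ, 0 < S → (S : EReal) ≤ T → MeanField.IsWeakSolution n S μ u)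
    (C : ℝ)
    (hC : ∀ᵐ t : ℝ, 0 < t → (t : EReal) < T →
      eLpNorm (u t) ∞ volume ≤ ENNReal.ofReal (C / t)) :
    ∃ ν : ℝ → Measure (MeanField.Space n),
      ν 0 = μ ∧
      (∀ᵐ t : ℝ, 0 < t → (t : EReal) < T → ν t = MeanField.densityMeasure (u t)) ∧
      (ContinuousOn (fun z : ℝ × MeanField.Space n => u z.1 z.2)
          {z | 0 < z.1 ∧ (z.1 : EReal) < T} →
        ∀ t : ℝ, 0 < t → (t : EReal) < T → ν t = MeanField.densityMeasure (u t)) ∧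
      ∀ q : ℝ, 1 ≤ q →
        (∃ m : ℝ → ℝ,
          (∀ S : ℝ, 0 < S → (S : EReal) ≤ T → IntegrableOn m (Ioo 0 S)) ∧
          ∀ t₁ t₂ : ℝ, 0 ≤ t₁ → t₁ ≤ t₂ → (t₂ : EReal) < T →
            MeanField.wasserstein q (ν t₂) (ν t₁) ≤ ENNReal.ofReal (∫ s in t₁..t₂, m s)) ∧
        ∀ t₀ : ℝ, 0 ≤ t₀ → (t₀ : EReal) < T →
          Tendsto (fun t => MeanField.wasserstein q (ν t) (ν t₀))
            (𝓝[{t : ℝ | 0 ≤ t ∧ (t : EReal) < T}] t₀) (𝓝 0) := by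
  obtain ⟨K, hK, E, hEae, hE0, hEM, hEμ, hEE⟩ :=
    MeanField.exists_good_times_of_isWeakSolution hn hT hu hC
  set R : ℝ → ℝ := MeanField.travelBound n K
  have hRc : Continuous R := MeanField.continuous_travelBound hn K
  have hR0 : R 0 = 0 := intervalIntegral.integral_same
  have hRm : ∀ {s t : ℝ}, 0 ≤ s → s ≤ t → R s ≤ R t := fun hs hst =>
    MeanField.travelBound_mono hn hK hs hst
  have hbase : ∀ s, ∃ m : FiniteMeasure (MeanField.Space n), (s = 0 → (m : Measure (MeanField.Space n)) = μ) ∧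
      (s ∈ E → (m : Measure (MeanField.Space n)) = MeanField.densityMeasure (u s)) := by
    intro s
    by_cases hs : s ∈ E
    · have := (hEM s hs).1
      exact ⟨⟨MeanField.densityMeasure (u s), this⟩, fun h => absurd h (hE0 s hs).1.ne', fun _ => rfl⟩
    -- Outside `E` the value `μ` is the right one at time `0` and a default elsewhere.
    · exact ⟨⟨μ, inferInstance⟩, fun _ => rfl, fun h => absurd h hs⟩
  choose b hb0 hbE using hbase
  have hbM : ∀ s ∈ insert 0 E, (b s : Measure (MeanField.Space n)) univ = μ univ := by
    rintro s (rfl | hs)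
    · rw [hb0 0 rfl]
    · rw [hbE s hs, (hEM s hs).2]
  have hlt : ∀ s ∈ insert 0 E, ∀ s' ∈ insert 0 E, s < s' →
      MeanField.Nearby (R s' - R s) (b s' : Measure (MeanField.Space n)) (b s) := by
    rintro s (rfl | hs) s' (rfl | hs') hss
    · exact absurd hss (lt_irrefl _)
    · rw [hb0 0 rfl, hbE s' hs', hR0, sub_zero]
      exact hEμ s' hs'
    · exact absurd hss (hE0 s hs).1.not_gt
    · rw [hbE s hs, hbE s' hs']
      exact hEE s hs s' hs' hss
  have hnn : ∀ s ∈ insert 0 E, 0 ≤ s := by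
    rintro s (rfl | hs)
    · exact le_rfl
    · exact (hE0 s hs).1.le
  have hbb : ∀ s ∈ insert 0 E, ∀ s' ∈ insert 0 E,
      MeanField.Nearby |R s - R s'| (b s : Measure (MeanField.Space n)) (b s') := by
    intro s hs s' hs'
    rcases lt_trichotomy s s' with h | rfl | h
    · have h1 := hRm (hnn s hs) h.le
      rw [abs_sub_comm, abs_of_nonneg (sub_nonneg.2 h1)]
      exact (hlt s hs s' hs' h).symm (sub_nonneg.2 h1) ((hbM s' hs').trans (hbM s hs).symm)
    · exact fun ε hε A hA => measure_mono (Metric.self_subset_cthickening _)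
    · rw [abs_of_nonneg (sub_nonneg.2 (hRm (hnn s' hs') h.le))]
      exact hlt s' hs' s hs h
  set O : Set ℝ := {t | 0 < t ∧ (t : EReal) < T}
  have hO : IsOpen O := (isOpen_lt continuous_const continuous_id).inter
    (isOpen_Iio.preimage continuous_coe_real_ereal)
  have hclE : ∀ t ∈ O, t ∈ closure E := by
    intro t ht
    have hdense : Dense {t : ℝ | 0 < t → (t : EReal) < T → t ∈ E} := Measure.dense_of_ae hEae
    exact closure_mono (fun s hs => hs.2 hs.1.1 hs.1.2) (hdense.open_subset_closure_inter hO ht)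
  have hcl : ∀ t : ℝ, 0 ≤ t → (t : EReal) < T → t ∈ closure (insert 0 E) := by
    intro t ht htT
    rcases ht.eq_or_lt with rfl | h
    · exact subset_closure (mem_insert _ _)
    · exact closure_mono (subset_insert _ _) (hclE t ⟨h, htT⟩)
  have hlimit : ∀ t : ℝ, ∃ ν' : FiniteMeasure (MeanField.Space n), 0 ≤ t → (t : EReal) < T →
      (ν' : Measure (MeanField.Space n)) univ = μ univ ∧
      (∀ s ∈ insert 0 E, MeanField.Nearby |R s - R t| (b s : Measure (MeanField.Space n)) ν') ∧
      (t ∈ insert 0 E → ν' = b t) := by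
    intro t
    by_cases htE : t ∈ insert 0 E
    · exact ⟨b t, fun _ _ => ⟨hbM t htE, fun s hs => hbb s hs t htE, fun _ => rfl⟩⟩
    by_cases ht : 0 ≤ t ∧ (t : EReal) < T
    · obtain ⟨ν', h1, h2⟩ := MeanField.exists_limit_measure hbM hbb (hcl t ht.1 ht.2)
        hRc.continuousWithinAt
      exact ⟨ν', fun _ _ => ⟨h1, h2, fun h => absurd h htE⟩⟩
    · exact ⟨0, fun h1 h2 => absurd ⟨h1, h2⟩ ht⟩
  choose ν hν using hlimit
  have hνν : ∀ t₁ t₂ : ℝ, 0 ≤ t₁ → (t₁ : EReal) < T → 0 ≤ t₂ → (t₂ : EReal) < T →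
      MeanField.Nearby |R t₂ - R t₁| (ν t₂ : Measure (MeanField.Space n)) (ν t₁) := by
    intro t₁ t₂ h1 h1T h2 h2T
    -- The relation is known only against times in `insert 0 E`. Two arbitrary times are compared
    -- through such an `s` with `R s` close to `R t₂`, at the price of an arbitrarily small loss.
    refine MeanField.Nearby.of_forall_lt fun r' hr' => ?_
    have hη : 0 < (r' - |R t₂ - R t₁|) / 2 := by linarith
    obtain ⟨s, hs, hsE⟩ := mem_closure_iff_nhds.1 (hcl t₂ h2 h2T) _
      ((hRc.tendsto t₂).eventually (Metric.ball_mem_nhds (R t₂) hη))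
    have hs' : |R s - R t₂| < (r' - |R t₂ - R t₁|) / 2 := hs
    have e1 := ((hν t₂ h2 h2T).2.1 s hsE).symm (abs_nonneg _)
      ((hbM s hsE).trans (hν t₂ h2 h2T).1.symm)
    have e2 := (hν t₁ h1 h1T).2.1 s hsE
    refine (e1.trans (abs_nonneg _) (abs_nonneg _) e2).mono ?_
    have := abs_sub_le (R s) (R t₂) (R t₁)
    linarith
  have hW : ∀ q : ℝ, 1 ≤ q → ∀ t₁ t₂ : ℝ, 0 ≤ t₁ → (t₁ : EReal) < T → 0 ≤ t₂ → (t₂ : EReal) < T →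
      MeanField.wasserstein q (ν t₂ : Measure (MeanField.Space n)) (ν t₁) ≤
        μ univ ^ (1 / q) * ENNReal.ofReal |R t₂ - R t₁| := by
    intro q hq t₁ t₂ h1 h1T h2 h2T
    rw [← (hν t₂ h2 h2T).1]
    exact MeanField.wasserstein_le_of_forall_isCompact hq
      ((hν t₂ h2 h2T).1.trans (hν t₁ h1 h1T).1.symm) (abs_nonneg _) (hνν t₁ t₂ h1 h1T h2 h2T)
  have hνE : ∀ t ∈ E, (ν t : Measure (MeanField.Space n)) = MeanField.densityMeasure (u t) := fun t ht => by
    rw [(hν t (hE0 t ht).1.le (hE0 t ht).2).2.2 (mem_insert_of_mem _ ht), hbE t ht]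
  refine ⟨fun t => ν t, ?_, ?_, fun hcont t ht htT => ?_, fun q hq => ⟨?_, fun t₀ h0 h0T => ?_⟩⟩
  · dsimp only
    rw [(hν 0 le_rfl (by simpa using hT)).2.2 (mem_insert _ _), hb0 0 rfl]
  · filter_upwards [hEae] with t ht h0 hT
    exact hνE t (ht h0 hT)
  · have hset : {z : ℝ × MeanField.Space n | 0 < z.1 ∧ (z.1 : EReal) < T} = O ×ˢ univ := by
      ext z; simp [O]
    rw [hset] at hcont
    have hρ : Tendsto (fun s => |R s - R t|) (𝓝[E] t) (𝓝 0) := by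
      have : Continuous fun s => |R s - R t| := (hRc.sub continuous_const).abs
      simpa using (this.tendsto t).mono_left nhdsWithin_le_nhds
    refine MeanField.eq_densityMeasure_of_nearby hO hcont ⟨ht, htT⟩ (hclE t ⟨ht, htT⟩) hρ
      (fun s hs => ?_) fun s hs => ?_
    · rw [← hνE s hs, abs_sub_comm]
      exact hνν s t (hE0 s hs).1.le (hE0 s hs).2 ht.le htT
    · rw [← hνE s hs]
      exact hνν t s ht.le htT (hE0 s hs).1.le (hE0 s hs).2
  -- The modulus is the maximal speed times the factor `μ(ℝⁿ)^(1/q)` by which the displacement bound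
  -- enters `W_q`.
  · refine ⟨fun s => (μ univ ^ (1 / q)).toReal * MeanField.speedBound n K s, fun S hS _ =>
      (MeanField.integrableOn_speedBound hn K hS.le).const_mul _, fun t₁ t₂ h1 h12 h2T => ?_⟩
    have hfin : μ univ ^ (1 / q) ≠ ⊤ :=
      ENNReal.rpow_ne_top_of_nonneg (by positivity) (measure_ne_top _ _)
    refine (hW q hq t₁ t₂ h1 ((EReal.coe_le_coe_iff.2 h12).trans_lt h2T) (h1.trans h12) h2T).trans_eq
      ?_
    rw [intervalIntegral.integral_const_mul, ENNReal.ofReal_mul ENNReal.toReal_nonneg,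
      ENNReal.ofReal_toReal hfin, ← MeanField.travelBound_sub hn,
      abs_of_nonneg (sub_nonneg.2 (hRm h1 h12))]
  · have hfin : μ univ ^ (1 / q) ≠ ⊤ :=
      ENNReal.rpow_ne_top_of_nonneg (by positivity) (measure_ne_top _ _)
    have hlim : Tendsto (fun t => μ univ ^ (1 / q) * ENNReal.ofReal |R t - R t₀|)
        (𝓝[{t : ℝ | 0 ≤ t ∧ (t : EReal) < T}] t₀) (𝓝 0) := by
      have h1 : Continuous fun t => |R t - R t₀| := (hRc.sub continuous_const).abs
      have h2 := ENNReal.Tendsto.const_mul (ENNReal.tendsto_ofReal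
        ((h1.tendsto t₀).mono_left (nhdsWithin_le_nhds (s := {t : ℝ | 0 ≤ t ∧ (t : EReal) < T}))))
        (.inr hfin)
      simpa using h2
    refine tendsto_of_tendsto_of_tendsto_of_le_of_le' tendsto_const_nhds hlim
      (.of_forall fun _ => zero_le) ?_
    filter_upwards [self_mem_nhdsWithin] with t ht
    exact hW q hq t₀ t h0 h0T ht.1 ht.2
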